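/- Let $\pi$ be an abelian group and let $n\ge 1$. A pointed space $(X,x_0)$ is said to be of type $K(\pi,n)$ if $\pi_n(X,x_0)\cong\pi$ as groups and $\pi_k(X,x_0)$ is trivial for every $k\ge 0$ with $k\neq n$ (for $k=0$ this means that $X$ is path connected). Let $X$ and $Y$ be CW complexes with base points $x_0\in X$ and $y_0\in Y$ such that $(X,x_0)$ and $(Y,y_0)$ are both of type $K(\pi,n)$. Then $X$ and $Y$ are homotopy equivalent. Moreover, if $x_0$ and $y_0$ are $0$-cells of $X$ and $Y$, then $(X,x_0)$ and $(Y,y_0)$ are homotopy equivalent as pointed spaces, i.e. through base-point-preserving maps and base-point-preserving homotopies. -/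

import Mathlib

open scoped Topology ContinuousMap

/-- The pointed space `(X, x₀)` is of type `K(G, n)`, where `n ≥ 1`: the group `π_n(X, x₀)` is
isomorphic to `G`, and `π_k(X, x₀)` is trivial for every other `k ≥ 0`. The case `k = 0`
says that `X` is path connected, `π_0(X, x₀)` being the set of path components. -/
structure IsEilenbergMacLane (G : Type*) [Group G] (n : ℕ) [NeZero n]
    (X : Type*) [TopologicalSpace X] (x₀ : X) : Prop where
  nonempty_mulEquiv : Nonempty (π_ n X x₀ ≃* G)
  subsingleton_of_ne (k : ℕ) (hk : k ≠ n) : Subsingleton (π_ k X x₀)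

/-- The pointed spaces `(X, x₀)` and `(Y, y₀)` are homotopy equivalent through base point
preserving maps and base point preserving homotopies. -/
def PointedHomotopyEquivalent (X : Type*) [TopologicalSpace X] (x₀ : X)
    (Y : Type*) [TopologicalSpace Y] (y₀ : Y) : Prop :=
  ∃ (f : C(X, Y)) (g : C(Y, X)), f x₀ = y₀ ∧ g y₀ = x₀ ∧
    (g.comp f).HomotopicRel (ContinuousMap.id X) {x₀} ∧
    (f.comp g).HomotopicRel (ContinuousMap.id Y) {y₀}

/-! Every homomorphism φ from π_n(X) to π_n(Y) is induced by a pointed map (`exists_map_inducing`),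
and that map is unique up to pointed homotopy (`homotopicRel_of_piClass_eq`). Applied to an
isomorphism φ and to its inverse, existence gives maps f and g in both directions, and uniqueness
makes the two composites homotopic to the identities. When the given base points are not vertices,
they are first moved to vertices along paths.

Both statements are obstruction theory, cell by cell. As X has no homotopy below degree n, the
identity of X is homotopic to a map r that collapses all cells of dimension less than n to x₀
(`exists_collapse`). Through r each n-cell defines an element of π_n(X), and f sends the cell to a
representative of the image of this element under φ. Cells of dimension above n + 1 give no
obstruction, because the higher homotopy of Y vanishes; the same holds for homotopies over cells of
dimension above n.

The crux is dimension n + 1, where f on the attaching sphere a must be null-homotopic. The composite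
of r with a is null, since r is defined on the whole cell, so it is enough that φ[r a] = [f a]. This
relation holds on the n-cells by construction, and `inSub_of_cells` carries it to every n-cube in
the n-skeleton with boundary in the lower skeleton. That theorem concerns a map h collapsing the
lower skeleton and a subgroup Γ; here h is the pair (r, f) and Γ is the graph of φ inside π_n(X ×
Y). Its proof is a degree argument. The cube is deformed so that the centers of the n-cells become
regular values, and the cells are expanded radially, which pushes everything away from the preimages
of the centers into the lower skeleton. After subdivision into small boxes, each box carries either
the trivial class or the class of a cell composed with reflections, hence an element of Γ. -/

namespace EilenbergMacLane

open scoped unitInterval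
open Metric Set

set_option linter.unusedSectionVars false

/-! ### Cubes and sup norm balls. In the sup norm the ball of dimension k + 1 is a cylinder over the
ball of dimension k. -/

section Coordinates

variable {k : ℕ}

/-- The affine homeomorphism from the unit cube onto the closed unit ball of the sup norm. -/
def cubeToBall (s : Fin k → I) : Fin k → ℝ := fun i => 2 * (s i : ℝ) - 1

/-- The inverse of `cubeToBall`, extended to the whole space by projecting. -/
noncomputable def ballToCube (x : Fin k → ℝ) : Fin k → I :=
  fun i => Set.projIcc 0 1 zero_le_one ((x i + 1) / 2)

@[fun_prop]
lemma continuous_cubeToBall : Continuous (cubeToBall (k := k)) := by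
  unfold cubeToBall; fun_prop

@[fun_prop]
lemma continuous_ballToCube : Continuous (ballToCube (k := k)) := by
  unfold ballToCube
  exact continuous_pi fun i => continuous_projIcc.comp (by fun_prop)

lemma cubeToBall_mem (s : Fin k → I) : cubeToBall s ∈ closedBall (0 : Fin k → ℝ) 1 := by
  rw [mem_closedBall_zero_iff, pi_norm_le_iff_of_nonneg zero_le_one]
  intro i
  have h0 := (s i).2.1
  have h1 := (s i).2.2
  rw [Real.norm_eq_abs, abs_le]
  simp only [cubeToBall]
  constructor <;> linarith

lemma ballToCube_cubeToBall (s : Fin k → I) : ballToCube (cubeToBall s) = s := by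
  funext i
  simp only [ballToCube, cubeToBall]
  rw [show (2 * (s i : ℝ) - 1 + 1) / 2 = s i by ring, projIcc_val]

lemma abs_le_one_of_mem {x : Fin k → ℝ} (hx : x ∈ closedBall (0 : Fin k → ℝ) 1) (i : Fin k) :
    |x i| ≤ 1 := by
  rw [mem_closedBall_zero_iff] at hx
  exact (norm_le_pi_norm x i).trans hx

lemma cubeToBall_ballToCube {x : Fin k → ℝ} (hx : x ∈ closedBall (0 : Fin k → ℝ) 1) :
    cubeToBall (ballToCube x) = x := by
  funext i
  have h := abs_le.1 (abs_le_one_of_mem hx i)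
  simp only [ballToCube, cubeToBall]
  rw [projIcc_of_mem zero_le_one (x := (x i + 1) / 2) ⟨by linarith, by linarith⟩]
  ring

lemma norm_eq_one_iff {x : Fin k → ℝ} (hx : x ∈ closedBall (0 : Fin k → ℝ) 1) :
    ‖x‖ = 1 ↔ ∃ i, x i = -1 ∨ x i = 1 := by
  constructor
  · intro h
    by_contra! hc
    have : ‖x‖ < 1 := by
      rw [pi_norm_lt_iff one_pos]
      intro i
      refine lt_of_le_of_ne (abs_le_one_of_mem hx i) fun h => ?_
      rcases eq_or_eq_neg_of_abs_eq h with h | h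
      exacts [(hc i).2 h, (hc i).1 h]
    exact this.ne h
  · rintro ⟨i, h⟩
    refine le_antisymm (mem_closedBall_zero_iff.1 hx) ?_
    have := norm_le_pi_norm x i
    rcases h with h | h <;> simpa [h] using this

lemma mem_boundary_iff (s : Fin k → I) : s ∈ Cube.boundary (Fin k) ↔ ‖cubeToBall s‖ = 1 := by
  rw [norm_eq_one_iff (cubeToBall_mem s)]
  refine exists_congr fun i => or_congr ?_ ?_
  · rw [← Subtype.coe_inj]
    simp only [cubeToBall, Icc.coe_zero]
    constructor <;> intro h <;> linarith
  · rw [← Subtype.coe_inj]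
    simp only [cubeToBall, Icc.coe_one]
    constructor <;> intro h <;> linarith

lemma ballToCube_mem_boundary {x : Fin k → ℝ} (hx : x ∈ sphere (0 : Fin k → ℝ) 1) :
    ballToCube x ∈ Cube.boundary (Fin k) := by
  rw [mem_boundary_iff, cubeToBall_ballToCube (sphere_subset_closedBall hx)]
  simpa using hx

lemma norm_cons (z : ℝ) (x : Fin k → ℝ) :
    ‖(Fin.cons z x : Fin (k + 1) → ℝ)‖ = max |z| ‖x‖ := by
  apply le_antisymm
  · rw [pi_norm_le_iff_of_nonneg (le_max_of_le_left (abs_nonneg z))]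
    intro i
    refine Fin.cases ?_ (fun j => ?_) i
    · exact le_max_left _ _
    · exact (norm_le_pi_norm x j).trans (le_max_right _ _)
  · apply max_le
    · exact norm_le_pi_norm (Fin.cons z x : Fin (k + 1) → ℝ) 0
    · rw [pi_norm_le_iff_of_nonneg (norm_nonneg _)]
      intro j
      exact norm_le_pi_norm (Fin.cons z x : Fin (k + 1) → ℝ) j.succ

@[fun_prop]
lemma continuous_cons {Z : Type*} [TopologicalSpace Z] {f : Z → ℝ} {g : Z → Fin k → ℝ}
    (hf : Continuous f) (hg : Continuous g) :
    Continuous fun p => (Fin.cons (f p) (g p) : Fin (k + 1) → ℝ) := by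
  refine continuous_pi fun i => ?_
  refine Fin.cases ?_ (fun j => ?_) i
  · simpa using hf
  · simpa using (continuous_pi_iff.1 hg) j

@[fun_prop]
lemma continuous_tail : Continuous (Fin.tail : (Fin (k + 1) → ℝ) → Fin k → ℝ) := by
  unfold Fin.tail; fun_prop

end Coordinates

/-! ### Homotopy extension for the ball. -/

section Extension

variable {E Z : Type*} [TopologicalSpace E] [TopologicalSpace Z]

/-- Maps on balls are handled as total functions that are continuous on a set; the values off the
set are arbitrary. -/
lemma exists_continuousOn_extension [Nonempty Z] {S : Set E} {f : S → Z} (hf : Continuous f) :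
    ∃ g : E → Z, ContinuousOn g S ∧ ∀ (x : E) (h : x ∈ S), g x = f ⟨x, h⟩ := by
  classical
  refine ⟨fun x => if h : x ∈ S then f ⟨x, h⟩ else Classical.arbitrary Z, ?_, fun x h => ?_⟩
  · rw [continuousOn_iff_continuous_domRestrict]
    convert hf using 1
    funext x
    simp
  · simp [h]

variable {V Y : Type*} [NormedAddCommGroup V] [NormedSpace ℝ V] [TopologicalSpace Y]

/-- The homotopy extension property of the closed unit ball relative to the unit sphere. -/
theorem ball_homotopy_extension {u : V → C(I, Y)} {v : V → Y}
    (hu : ContinuousOn u (sphere 0 1)) (hv : ContinuousOn v (closedBall 0 1))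
    (huv : ∀ x ∈ sphere (0 : V) 1, u x 0 = v x) :
    ∃ w : V → C(I, Y), ContinuousOn w (closedBall 0 1) ∧ EqOn w u (sphere 0 1) ∧
      ∀ x ∈ closedBall (0 : V) 1, w x 0 = v x := by
  classical
  have : Nonempty C(I, Y) := ⟨u 0⟩
  let B := closedBall (0 : V) 1
  -- Projection of the cylinder from the point `(0, 2)` above it: a point lands on the bottom, where
  -- `v` applies, or on the side, where `u` applies.
  let G : B × I → Y := fun p =>
    if 2 * ‖p.1.1‖ ≤ 2 - (p.2 : ℝ) then v ((2 / (2 - (p.2 : ℝ))) • p.1.1)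
    else u (‖p.1.1‖⁻¹ • p.1.1)
      (projIcc 0 1 zero_le_one (2 - (2 - (p.2 : ℝ)) / ‖p.1.1‖))
  have hpos : ∀ t : I, (0 : ℝ) < 2 - t := fun t => by linarith [t.2.2]
  have hG : Continuous G := by
    refine continuous_if_le (by fun_prop) (by fun_prop) ?_ ?_ ?_
    · refine hv.comp (Continuous.continuousOn ?_) ?_
      · refine Continuous.smul (Continuous.div continuous_const (by fun_prop) ?_) (by fun_prop)
        exact fun p => (hpos p.2).ne'
      · intro p hp
        have := hpos p.2
        simp only [mem_ofPred_eq] at hp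
        rw [mem_closedBall_zero_iff, norm_smul, Real.norm_of_nonneg (by positivity), div_mul_eq_mul_div,
          div_le_one this]
        exact hp
    · have hne : ∀ p ∈ {p : B × I | 2 - (p.2 : ℝ) ≤ 2 * ‖p.1.1‖}, ‖p.1.1‖ ≠ 0 := by
        intro p hp h
        have := hpos p.2
        simp only [mem_ofPred_eq, h] at hp
        linarith
      have h1 : ContinuousOn (fun p : B × I => u (‖p.1.1‖⁻¹ • p.1.1))
          {p | 2 - (p.2 : ℝ) ≤ 2 * ‖p.1.1‖} := by
        refine hu.comp ?_ ?_
        · exact ContinuousOn.smul (ContinuousOn.inv₀ (by fun_prop) hne) (by fun_prop)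
        · intro p hp
          rw [mem_sphere_zero_iff_norm, norm_smul, norm_inv, norm_norm,
            inv_mul_cancel₀ (hne p hp)]
      have h2 : ContinuousOn (fun p : B × I =>
          projIcc (0 : ℝ) 1 zero_le_one (2 - (2 - (p.2 : ℝ)) / ‖p.1.1‖))
          {p | 2 - (p.2 : ℝ) ≤ 2 * ‖p.1.1‖} := by
        refine continuous_projIcc.comp_continuousOn ?_
        exact ContinuousOn.sub (by fun_prop) (ContinuousOn.div (by fun_prop) (by fun_prop) hne)
      exact continuous_eval.comp_continuousOn (h1.prodMk h2)
    · intro p hp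
      have := hpos p.2
      have hn : ‖p.1.1‖ = (2 - (p.2 : ℝ)) / 2 := by linarith
      have hn0 : ‖p.1.1‖ ≠ 0 := by rw [hn]; positivity
      have h1 : 2 / (2 - (p.2 : ℝ)) = ‖p.1.1‖⁻¹ := by rw [hn, inv_div]
      have h2 : 2 - (2 - (p.2 : ℝ)) / ‖p.1.1‖ = 0 := by rw [hn]; field_simp; ring
      rw [h1, h2, projIcc_left]
      refine (huv _ ?_).symm
      rw [mem_sphere_zero_iff_norm, norm_smul, norm_inv, norm_norm, inv_mul_cancel₀ hn0]
  obtain ⟨w, hw, hw'⟩ := exists_continuousOn_extension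
    (ContinuousMap.curry ⟨G, hG⟩ : C(B, C(I, Y))).continuous
  refine ⟨w, hw, fun x hx => ?_, fun x hx => ?_⟩
  · rw [hw' x (sphere_subset_closedBall hx)]
    ext t
    have hx1 : ‖x‖ = 1 := by simpa using hx
    simp only [ContinuousMap.curry_apply, ContinuousMap.coe_mk, G, hx1, inv_one, one_smul, div_one]
    split_ifs with h
    · have ht : t = 0 := le_antisymm (Subtype.coe_le_coe.1 (by simpa using by linarith)) t.2.1
      subst ht
      simpa using (huv x hx).symm
    · rw [show 2 - (2 - (t : ℝ)) = t by ring, projIcc_val]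
  · rw [hw' x hx]
    have hx1 : ‖x‖ ≤ 1 := by simpa using hx
    simp only [ContinuousMap.curry_apply, ContinuousMap.coe_mk, G, Icc.coe_zero, sub_zero]
    rw [if_pos (by linarith)]
    norm_num

end Extension

/-! ### Gluing maps on the boundary of a cylinder. -/

section Glue

variable {k : ℕ} {Z : Type*} [TopologicalSpace Z]

/-- A continuous map on the boundary of a cylinder over the ball is given by compatible maps on
its two ends and its side. -/
lemma exists_sphere_glue {A₀ A₁ : (Fin k → ℝ) → Z} {B : I → (Fin k → ℝ) → Z}
    (h₀ : ContinuousOn A₀ (closedBall 0 1)) (h₁ : ContinuousOn A₁ (closedBall 0 1))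
    (hB : ContinuousOn (fun p : I × (Fin k → ℝ) => B p.1 p.2) (univ ×ˢ sphere 0 1))
    (hB₀ : ∀ x ∈ sphere (0 : Fin k → ℝ) 1, B 0 x = A₀ x)
    (hB₁ : ∀ x ∈ sphere (0 : Fin k → ℝ) 1, B 1 x = A₁ x) :
    ∃ U : (Fin (k + 1) → ℝ) → Z, ContinuousOn U (sphere 0 1) ∧
      (∀ x ∈ closedBall (0 : Fin k → ℝ) 1, U (Fin.cons (-1) x) = A₀ x) ∧
      (∀ x ∈ closedBall (0 : Fin k → ℝ) 1, U (Fin.cons 1 x) = A₁ x) ∧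
      ∀ t : I, ∀ x ∈ sphere (0 : Fin k → ℝ) 1, U (Fin.cons (2 * (t : ℝ) - 1) x) = B t x := by
  classical
  let U : (Fin (k + 1) → ℝ) → Z := fun y =>
    if y 0 = -1 then A₀ (Fin.tail y) else if y 0 = 1 then A₁ (Fin.tail y)
    else B (projIcc 0 1 zero_le_one ((y 0 + 1) / 2)) (Fin.tail y)
  have hneg : ∀ x : Fin k → ℝ, U (Fin.cons (-1) x) = A₀ x := fun x => by simp [U]
  have hone : ∀ x : Fin k → ℝ, U (Fin.cons 1 x) = A₁ x := fun x => by
    simp only [U, Fin.cons_zero, Fin.tail_cons, if_true]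
    rw [if_neg (by norm_num)]
  have hside : ∀ t : I, ∀ x ∈ sphere (0 : Fin k → ℝ) 1,
      U (Fin.cons (2 * (t : ℝ) - 1) x) = B t x := by
    intro t x hx
    by_cases h0 : (t : ℝ) = 0
    · have : t = 0 := Subtype.ext h0
      subst this
      rw [hB₀ x hx]; simp [U]
    by_cases h1 : (t : ℝ) = 1
    · have : t = 1 := Subtype.ext h1
      subst this
      rw [hB₁ x hx]
      convert hone x using 3
      norm_num
    simp only [U, Fin.cons_zero, Fin.tail_cons]
    rw [if_neg (fun h => h0 (by linarith)), if_neg (fun h => h1 (by linarith)),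
      show (2 * (t : ℝ) - 1 + 1) / 2 = t by ring, projIcc_val]
  have htail : ∀ y ∈ sphere (0 : Fin (k + 1) → ℝ) 1, |y 0| ≤ 1 ∧ ‖Fin.tail y‖ ≤ 1 ∧
      (y 0 = -1 ∨ y 0 = 1 ∨ ‖Fin.tail y‖ = 1) := by
    intro y hy
    rw [mem_sphere_zero_iff_norm, ← Fin.cons_self_tail y, norm_cons] at hy
    refine ⟨hy ▸ le_max_left _ _, hy ▸ le_max_right _ _, ?_⟩
    rcases max_choice |y 0| ‖Fin.tail y‖ with h | h
    · rw [h] at hy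
      rcases eq_or_eq_neg_of_abs_eq hy with h | h
      exacts [.inr (.inl h), .inl h]
    · rw [h] at hy; exact .inr (.inr hy)
  refine ⟨U, ?_, fun x _ => hneg x, fun x _ => hone x, hside⟩
  let S₀ : Set (Fin (k + 1) → ℝ) := sphere 0 1 ∩ {y | y 0 = -1}
  let S₁ : Set (Fin (k + 1) → ℝ) := sphere 0 1 ∩ {y | y 0 = 1}
  let S₂ : Set (Fin (k + 1) → ℝ) := sphere 0 1 ∩ {y | ‖Fin.tail y‖ = 1}
  have c₀ : IsClosed S₀ := isClosed_sphere.inter (isClosed_eq (by fun_prop) (by fun_prop))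
  have c₁ : IsClosed S₁ := isClosed_sphere.inter (isClosed_eq (by fun_prop) (by fun_prop))
  have c₂ : IsClosed S₂ := isClosed_sphere.inter (isClosed_eq (by fun_prop) (by fun_prop))
  have k₀ : ContinuousOn U S₀ := by
    refine ContinuousOn.congr (f := fun y => A₀ (Fin.tail y)) ?_ ?_
    · exact h₀.comp continuous_tail.continuousOn fun y hy => by
        simpa using (htail y hy.1).2.1
    · intro y hy
      have := hneg (Fin.tail y)
      rwa [← show y 0 = -1 from hy.2, Fin.cons_self_tail] at this
  have k₁ : ContinuousOn U S₁ := by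
    refine ContinuousOn.congr (f := fun y => A₁ (Fin.tail y)) ?_ ?_
    · exact h₁.comp continuous_tail.continuousOn fun y hy => by
        simpa using (htail y hy.1).2.1
    · intro y hy
      have := hone (Fin.tail y)
      rwa [← show y 0 = 1 from hy.2, Fin.cons_self_tail] at this
  have k₂ : ContinuousOn U S₂ := by
    refine ContinuousOn.congr
      (f := fun y => B (projIcc 0 1 zero_le_one ((y 0 + 1) / 2)) (Fin.tail y)) ?_ ?_
    · refine hB.comp (f := fun y : Fin (k + 1) → ℝ =>
        ((projIcc 0 1 zero_le_one ((y 0 + 1) / 2) : I), Fin.tail y)) ?_ ?_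
      · exact ((continuous_projIcc.comp (by fun_prop)).prodMk continuous_tail).continuousOn
      · intro y hy
        exact ⟨mem_univ _, by simpa using hy.2⟩
    · intro y hy
      have h := abs_le.1 (htail y hy.1).1
      have hm : (y 0 + 1) / 2 ∈ Icc (0 : ℝ) 1 := ⟨by linarith, by linarith⟩
      have := hside ⟨_, hm⟩ (Fin.tail y) (by simpa using hy.2)
      beta_reduce
      rw [projIcc_of_mem zero_le_one hm, ← this]
      congr 1
      conv_lhs => rw [← Fin.cons_self_tail y]
      congr 1
      simp only; ring
  refine ((k₀.union_of_isClosed (k₁.union_of_isClosed k₂ c₁ c₂) c₀ (c₁.union c₂))).mono ?_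
  intro y hy
  rcases (htail y hy).2.2 with h | h | h
  exacts [.inl ⟨hy, h⟩, .inr (.inl ⟨hy, h⟩), .inr (.inr ⟨hy, h⟩)]

end Glue

/-! ### Free homotopies of cubes whose boundary follows a path. -/

section Drag

variable {k : ℕ} {Y Z : Type*} [TopologicalSpace Y] [TopologicalSpace Z] {y y' y'' : Y}

/-- The maps `a` and `b` from the cube are homotopic through maps which are constant on the
boundary, with value moving along the path `γ`. -/
def Drag (γ : Path y y') (a b : C(Fin k → I, Y)) : Prop :=
  ∃ H : a.Homotopy b, ∀ t, ∀ s ∈ Cube.boundary (Fin k), H (t, s) = γ t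

lemma Drag.of_homotopicRel {a b : C(Fin k → I, Y)}
    (h : a.HomotopicRel b (Cube.boundary (Fin k))) (ha : ∀ s ∈ Cube.boundary (Fin k), a s = y) :
    Drag (Path.refl y) a b := by
  obtain ⟨H⟩ := h
  exact ⟨H.toHomotopy, fun t s hs => (H.eq_fst t hs).trans (ha s hs)⟩

lemma Drag.symm {γ : Path y y'} {a b : C(Fin k → I, Y)} (h : Drag γ a b) : Drag γ.symm b a := by
  obtain ⟨H, hH⟩ := h
  refine ⟨H.symm, fun t s hs => ?_⟩
  rw [ContinuousMap.Homotopy.symm_apply]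
  exact hH _ s hs

lemma Drag.trans {γ : Path y y'} {γ' : Path y' y''} {a b c : C(Fin k → I, Y)} (h : Drag γ a b)
    (h' : Drag γ' b c) : Drag (γ.trans γ') a c := by
  obtain ⟨H, hH⟩ := h
  obtain ⟨H', hH'⟩ := h'
  refine ⟨H.trans H', fun t s hs => ?_⟩
  rw [ContinuousMap.Homotopy.trans_apply, Path.trans_apply]
  split_ifs
  · exact hH _ s hs
  · exact hH' _ s hs

lemma Drag.comp {γ : Path y y'} {a b : C(Fin k → I, Y)} (h : Drag γ a b) (F : C(Y, Z)) :
    Drag (γ.map F.continuous) (F.comp a) (F.comp b) := by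
  obtain ⟨H, hH⟩ := h
  refine ⟨⟨F.comp H.toContinuousMap, fun s => ?_, fun s => ?_⟩, fun t s hs => ?_⟩
  · exact congrArg F (H.apply_zero s)
  · exact congrArg F (H.apply_one s)
  · exact congrArg F (hH t s hs)

lemma drag_const (γ : Path y y') :
    Drag γ (ContinuousMap.const (Fin k → I) y) (ContinuousMap.const (Fin k → I) y') :=
  ⟨⟨⟨fun p => γ p.1, by fun_prop⟩, fun _ => γ.source, fun _ => γ.target⟩, fun _ _ _ => rfl⟩

/-- This is the homotopy extension property, applied to the homotopy of the boundary that follows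
`γ` at all points simultaneously. -/
lemma exists_drag (γ : Path y y') (a : C(Fin k → I, Y))
    (ha : ∀ s ∈ Cube.boundary (Fin k), a s = y) :
    ∃ b : C(Fin k → I, Y), (∀ s ∈ Cube.boundary (Fin k), b s = y') ∧ Drag γ a b := by
  obtain ⟨w, hw, hw1, hw0⟩ := ball_homotopy_extension (V := Fin k → ℝ)
    (u := fun _ => γ.toContinuousMap) (v := fun x => a (ballToCube x)) continuousOn_const
    (by fun_prop) (fun x hx => by
      rw [ha _ (ballToCube_mem_boundary hx)]; exact γ.source)
  have hc : Continuous fun s : Fin k → I => w (cubeToBall s) :=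
    hw.comp_continuous continuous_cubeToBall cubeToBall_mem
  have hbd : ∀ t, ∀ s ∈ Cube.boundary (Fin k), w (cubeToBall s) t = γ t := by
    intro t s hs
    rw [hw1 (by simpa using (mem_boundary_iff s).1 hs)]; rfl
  refine ⟨⟨fun s => w (cubeToBall s) 1, (continuous_eval_const 1).comp hc⟩, fun s hs => ?_,
    ⟨⟨⟨fun p => w (cubeToBall p.2) p.1, ?_⟩, fun s => ?_, fun s => rfl⟩, hbd⟩⟩
  · exact (hbd 1 s hs).trans γ.target
  · exact continuous_eval.comp ((hc.comp continuous_snd).prodMk continuous_fst)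
  · exact (hw0 _ (cubeToBall_mem s)).trans (by rw [ballToCube_cubeToBall])

/-- If the boundary moves along a null-homotopic loop, the homotopy can be made stationary on the
boundary. -/
lemma Drag.homotopicRel {δ : Path y y} {a b : C(Fin k → I, Y)} (h : Drag δ a b)
    (hδ : δ.Homotopic (Path.refl y)) : a.HomotopicRel b (Cube.boundary (Fin k)) := by
  obtain ⟨H, hH⟩ := h
  obtain ⟨D⟩ := hδ
  -- Homotopy extension is applied to `H`, seen as a map on the cylinder: on the side the
  -- null-homotopy `D` contracts the loop, while the two ends stay fixed. The final stage of the
  -- extension is the homotopy sought.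
  obtain ⟨U, hU, hU0, hU1, hUs⟩ := exists_sphere_glue (k := k)
    (A₀ := fun x => ContinuousMap.const I (a (ballToCube x)))
    (A₁ := fun x => ContinuousMap.const I (b (ballToCube x)))
    (B := fun t _ => (⟨fun τ => D (τ, t), by fun_prop⟩ : C(I, Y)))
    (ContinuousMap.const'.continuous.comp (a.continuous.comp continuous_ballToCube)).continuousOn
    (ContinuousMap.const'.continuous.comp (b.continuous.comp continuous_ballToCube)).continuousOn
    (by
      refine Continuous.continuousOn ?_
      exact ContinuousMap.continuous_of_continuous_uncurry _
        (by simp only [Function.uncurry_def]; exact D.continuous.comp (by fun_prop)))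
    (fun x hx => by
      ext τ
      have h1 := hH 0 _ (ballToCube_mem_boundary hx)
      simp only [ContinuousMap.Homotopy.apply_zero, Path.source] at h1
      simp [h1])
    (fun x hx => by
      ext τ
      have h1 := hH 1 _ (ballToCube_mem_boundary hx)
      simp only [ContinuousMap.Homotopy.apply_one, Path.target] at h1
      simp [h1])
  let v : (Fin (k + 1) → ℝ) → Y := fun y =>
    H (projIcc 0 1 zero_le_one ((y 0 + 1) / 2), ballToCube (Fin.tail y))
  have hv : Continuous v :=
    H.continuous.comp ((continuous_projIcc.comp (by fun_prop)).prodMk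
      (continuous_ballToCube.comp continuous_tail))
  have hvt : ∀ (t : I) x, v (Fin.cons (2 * (t : ℝ) - 1) x) = H (t, ballToCube x) := by
    intro t x
    simp only [v, Fin.cons_zero, Fin.tail_cons]
    rw [show (2 * (t : ℝ) - 1 + 1) / 2 = t by ring, projIcc_val]
  have hsph : ∀ z ∈ sphere (0 : Fin (k + 1) → ℝ) 1, ∃ (t : I) (x : Fin k → ℝ),
      x ∈ closedBall (0 : Fin k → ℝ) 1 ∧ z = Fin.cons (2 * (t : ℝ) - 1) x ∧
        (t = 0 ∨ t = 1 ∨ x ∈ sphere (0 : Fin k → ℝ) 1) := by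
    intro z hz
    have hz' := hz
    rw [mem_sphere_zero_iff_norm, ← Fin.cons_self_tail z, norm_cons] at hz
    have h0 : |z 0| ≤ 1 := hz ▸ le_max_left _ _
    have h1 : ‖Fin.tail z‖ ≤ 1 := hz ▸ le_max_right _ _
    have h0' := abs_le.1 h0
    refine ⟨⟨(z 0 + 1) / 2, by linarith, by linarith⟩, Fin.tail z, by simpa using h1, ?_, ?_⟩
    · conv_lhs => rw [← Fin.cons_self_tail z]
      congr 1; simp only; ring
    · rcases max_choice |z 0| ‖Fin.tail z‖ with h | h
      · rw [h] at hz
        rcases eq_or_eq_neg_of_abs_eq hz with h | h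
        · exact .inr (.inl (Subtype.ext (by simp [h])))
        · exact .inl (Subtype.ext (by simp [h]))
      · rw [h] at hz; exact .inr (.inr (by simpa using hz))
  obtain ⟨w, hw, hw1, hw0⟩ := ball_homotopy_extension hU hv.continuousOn (fun z hz => by
    obtain ⟨t, x, hx, rfl, h⟩ := hsph z hz
    rw [hvt]
    rcases h with rfl | rfl | h
    · simp only [Icc.coe_zero, mul_zero, zero_sub]; rw [hU0 x hx]; simp
    · rw [show (2 * ((1 : I) : ℝ) - 1) = 1 by norm_num, hU1 x hx]; simp
    · rw [hUs t x h, hH t _ (ballToCube_mem_boundary h)]; simp)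
  let c : I × (Fin k → I) → (Fin (k + 1) → ℝ) := fun p =>
    Fin.cons (2 * (p.1 : ℝ) - 1) (cubeToBall p.2)
  have hc : Continuous c := by fun_prop
  have hcm : ∀ p, c p ∈ closedBall (0 : Fin (k + 1) → ℝ) 1 := by
    intro p
    rw [mem_closedBall_zero_iff, norm_cons, max_le_iff, abs_le]
    have h1 := p.1.2.1
    have h2 := p.1.2.2
    exact ⟨⟨by linarith, by linarith⟩, by simpa using cubeToBall_mem p.2⟩
  have hwc : Continuous fun p => w (c p) := hw.comp_continuous hc hcm
  have e0 : ∀ s, w (c (0, s)) 1 = a s := by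
    intro s
    have hm : c (0, s) ∈ sphere (0 : Fin (k + 1) → ℝ) 1 := by
      rw [mem_sphere_zero_iff_norm, norm_cons]
      simpa using cubeToBall_mem s
    rw [hw1 hm]
    simp only [c, Icc.coe_zero, mul_zero, zero_sub]
    rw [hU0 _ (cubeToBall_mem s)]
    simp [ballToCube_cubeToBall]
  have e1 : ∀ s, w (c (1, s)) 1 = b s := by
    intro s
    have hm : c (1, s) ∈ sphere (0 : Fin (k + 1) → ℝ) 1 := by
      rw [mem_sphere_zero_iff_norm, norm_cons]
      have := cubeToBall_mem s
      norm_num at this ⊢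
      exact this
    rw [hw1 hm]
    simp only [c]
    rw [show (2 * ((1 : I) : ℝ) - 1) = 1 by norm_num, hU1 _ (cubeToBall_mem s)]
    simp [ballToCube_cubeToBall]
  refine ⟨⟨⟨⟨fun p => w (c p) 1, (continuous_eval_const 1).comp hwc⟩, e0, e1⟩, fun t s hs => ?_⟩⟩
  have hsb : cubeToBall s ∈ sphere (0 : Fin k → ℝ) 1 := by simpa using (mem_boundary_iff s).1 hs
  have hm : c (t, s) ∈ sphere (0 : Fin (k + 1) → ℝ) 1 := by
    have := hcm (t, s)
    rw [mem_closedBall_zero_iff] at this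
    rw [mem_sphere_zero_iff_norm]
    refine le_antisymm this ?_
    rw [norm_cons, (mem_boundary_iff s).1 hs]
    exact le_max_right _ _
  have ha : a s = y := by
    have := hH 0 s hs
    simpa using this
  change w (c (t, s)) 1 = a s
  rw [hw1 hm, hUs t _ hsb, ha]
  simp

end Drag

/-! ### Classes of generalized loops. -/

section PiClass

open Topology.Homotopy

variable {N X : Type*} [TopologicalSpace X] {x : X}

/-- The class of a generalized loop in the homotopy group. -/
def piClass (p : Ω^ N X x) : HomotopyGroup N X x := Quotient.mk (GenLoop.Homotopic.setoid N x) p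

lemma piClass_surjective : Function.Surjective (piClass (N := N) (x := x)) := Quotient.mk_surjective

lemma piClass_eq_iff {p q : Ω^ N X x} :
    piClass p = piClass q ↔ p.1.HomotopicRel q.1 (Cube.boundary N) :=
  Quotient.eq (r := GenLoop.Homotopic.setoid N x)

variable [DecidableEq N] [Nonempty N]

lemma piClass_const : piClass (GenLoop.const : Ω^ N X x) = 1 := rfl

/-- In this convention the second factor of the product occupies the lower half of the cube in
direction `i`. -/
lemma piClass_mul (i : N) (p q : Ω^ N X x) :
    piClass p * piClass q = piClass (GenLoop.transAt i q p) := HomotopyGroup.mul_spec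

lemma piClass_inv (i : N) (p : Ω^ N X x) : (piClass p)⁻¹ = piClass (GenLoop.symmAt i p) :=
  HomotopyGroup.inv_spec

end PiClass

/-! ### Change of base point. -/

section BasePoint

open Topology.Homotopy

variable {k : ℕ} {Y : Type*} [TopologicalSpace Y] {y y' : Y}

/-- The two homotopies are concatenated at each time. They agree on the middle wall, because there
both are evaluated on the boundary of the cube and equal `γ t`. -/
lemma Drag.transAt {γ : Path y y'} {a a' : Ω^ (Fin k) Y y} {b b' : Ω^ (Fin k) Y y'}
    (i : Fin k) (h : Drag γ a.1 b.1) (h' : Drag γ a'.1 b'.1) :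
    Drag γ (GenLoop.transAt i a a').1 (GenLoop.transAt i b b').1 := by
  obtain ⟨H, hH⟩ := h
  obtain ⟨H', hH'⟩ := h'
  let G : I × (Fin k → I) → Y := fun p =>
    if (p.2 i : ℝ) ≤ 1 / 2
    then H (p.1, Function.update p.2 i (projIcc 0 1 zero_le_one (2 * p.2 i)))
    else H' (p.1, Function.update p.2 i (projIcc 0 1 zero_le_one (2 * p.2 i - 1)))
  have hb1 : ∀ s : Fin k → I, (s i : ℝ) = 1 / 2 →
      Function.update s i (projIcc 0 1 zero_le_one (2 * s i : ℝ)) ∈ Cube.boundary (Fin k) := by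
    intro s hs
    refine ⟨i, .inr ?_⟩
    rw [Function.update_self, hs]; norm_num
  have hb2 : ∀ s : Fin k → I, (s i : ℝ) = 1 / 2 →
      Function.update s i (projIcc 0 1 zero_le_one (2 * s i - 1 : ℝ)) ∈ Cube.boundary (Fin k) := by
    intro s hs
    refine ⟨i, .inl ?_⟩
    rw [Function.update_self, hs]; norm_num
  have hG : Continuous G := by
    refine continuous_if_le (by fun_prop) continuous_const ?_ ?_ ?_
    · refine (H.continuous.comp ?_).continuousOn
      exact continuous_fst.prodMk
        (continuous_snd.update i (continuous_projIcc.comp (by fun_prop)))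
    · refine (H'.continuous.comp ?_).continuousOn
      exact continuous_fst.prodMk
        (continuous_snd.update i (continuous_projIcc.comp (by fun_prop)))
    · intro p hp
      rw [hH _ _ (hb1 _ hp), hH' _ _ (hb2 _ hp)]
  have hupd : ∀ (s : Fin k → I) (c : I), s ∈ Cube.boundary (Fin k) → (s i ≠ 0 ∧ s i ≠ 1 ∨
      c = 0 ∨ c = 1) → Function.update s i c ∈ Cube.boundary (Fin k) := by
    rintro s c ⟨j, hj⟩ hc
    by_cases hji : j = i
    · subst hji
      rcases hc with hc | hc
      · tauto
      · exact ⟨j, by simpa using hc⟩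
    · exact ⟨j, by rwa [Function.update_of_ne hji]⟩
  refine ⟨⟨⟨G, hG⟩, fun s => ?_, fun s => ?_⟩, fun t s hs => ?_⟩
  · simp only [G, ContinuousMap.Homotopy.apply_zero]; rfl
  · simp only [G, ContinuousMap.Homotopy.apply_one]; rfl
  · change G (t, s) = γ t
    have h0 : s i = 0 → projIcc (0 : ℝ) 1 zero_le_one (2 * (s i : ℝ)) = 0 := fun h => by
      simp [h]
    have h1 : s i = 1 → projIcc (0 : ℝ) 1 zero_le_one (2 * (s i : ℝ) - 1) = 1 := fun h => by
      rw [h]; norm_num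
    simp only [G]
    split_ifs with hi
    · refine hH _ _ (hupd s _ hs ?_)
      by_cases h : s i = 0
      · exact .inr (.inl (h0 h))
      · exact .inl ⟨h, fun h => by rw [h] at hi; norm_num at hi⟩
    · refine hH' _ _ (hupd s _ hs ?_)
      by_cases h : s i = 1
      · exact .inr (.inr (h1 h))
      · exact .inl ⟨fun h => by rw [h] at hi; norm_num at hi, h⟩

/-- Going back along `h`, across `haa` and forward along `h'` drags the boundary around a loop
homotopic to γ⁻¹γ, so `Drag.homotopicRel` applies. -/
lemma Drag.homotopic_unique {γ : Path y y'} {a a' : C(Fin k → I, Y)} {b b' : C(Fin k → I, Y)}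
    (h : Drag γ a b) (h' : Drag γ a' b') (haa : a.HomotopicRel a' (Cube.boundary (Fin k)))
    (ha : ∀ s ∈ Cube.boundary (Fin k), a s = y) :
    b.HomotopicRel b' (Cube.boundary (Fin k)) := by
  refine (h.symm.trans ((Drag.of_homotopicRel haa ha).trans h')).homotopicRel ?_
  refine Path.Homotopic.trans (Path.Homotopic.hcomp (Path.Homotopic.refl _)
    (Path.Homotopic.refl_trans γ)) ?_
  exact Path.Homotopic.symm_trans γ

/-- A path induces an isomorphism between the homotopy groups at its end points. -/
theorem nonempty_homotopyGroup_mulEquiv [Nonempty (Fin k)] (γ : Path y y') :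
    Nonempty (HomotopyGroup (Fin k) Y y ≃* HomotopyGroup (Fin k) Y y') := by
  have key : ∀ a : Ω^ (Fin k) Y y, ∃ b : Ω^ (Fin k) Y y', Drag γ a.1 b.1 := fun a => by
    obtain ⟨b, hb, h⟩ := exists_drag γ a.1 a.2
    exact ⟨⟨b, hb⟩, h⟩
  choose T hT using key
  let i : Fin k := Classical.arbitrary _
  have hlift : ∀ p : HomotopyGroup (Fin k) Y y, ∃ q : HomotopyGroup (Fin k) Y y',
      ∀ a, piClass a = p → piClass (T a) = q := by
    intro p
    obtain ⟨a, rfl⟩ := piClass_surjective p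
    exact ⟨piClass (T a), fun a' h => piClass_eq_iff.2
      ((hT a').homotopic_unique (hT a) (piClass_eq_iff.1 h) a'.2)⟩
  choose F hF' using hlift
  have hF : ∀ a, F (piClass a) = piClass (T a) := fun a => (hF' _ a rfl).symm
  have hmul : ∀ p q, F (p * q) = F p * F q := by
    intro p q
    obtain ⟨a, rfl⟩ := piClass_surjective p
    obtain ⟨a', rfl⟩ := piClass_surjective q
    rw [piClass_mul i, hF, hF, hF, piClass_mul i, piClass_eq_iff]
    exact (hT _).homotopic_unique (Drag.transAt i (hT a') (hT a))
      (ContinuousMap.HomotopicRel.refl _) (GenLoop.transAt i a' a).2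
  refine ⟨MulEquiv.ofBijective (MonoidHom.mk' F hmul) ⟨?_, ?_⟩⟩
  · intro p q h
    obtain ⟨a, rfl⟩ := piClass_surjective p
    obtain ⟨a', rfl⟩ := piClass_surjective q
    change F _ = F _ at h
    rw [hF, hF, piClass_eq_iff] at h
    exact piClass_eq_iff.2 ((hT a).symm.homotopic_unique (hT a').symm h (T a).2)
  · intro q
    obtain ⟨b, rfl⟩ := piClass_surjective q
    obtain ⟨a, ha, h⟩ := exists_drag γ.symm b.1 b.2
    refine ⟨piClass ⟨a, ha⟩, ?_⟩
    change F _ = _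
    rw [hF, piClass_eq_iff]
    have h3 := h.symm
    rw [Path.symm_symm] at h3
    exact (hT ⟨a, ha⟩).homotopic_unique h3 (ContinuousMap.HomotopicRel.refl _) ha

end BasePoint

/-! ### The sphere as a ball with collapsed boundary. -/

section Theta

variable {k : ℕ}

/-- The point of the sphere to which `theta` collapses the boundary of the ball. -/
def pole (k : ℕ) : Fin (k + 1) → ℝ := Fin.cons 1 0

/-- A map from the ball of dimension `k` onto the sphere in dimension `k + 1` which collapses the
boundary to a point and is injective elsewhere. -/
noncomputable def theta (x : Fin k → ℝ) : Fin (k + 1) → ℝ :=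
  Fin.cons (max (-1) (min 1 (6 * ‖x‖ - 3)))
    ((min 1 (3 * (1 - ‖x‖)) / max ‖x‖ (1 / 3)) • x)

lemma continuous_theta : Continuous (theta (k := k)) := by
  unfold theta
  have hne : ∀ x : Fin k → ℝ, max ‖x‖ (1 / 3) ≠ 0 := fun x =>
    (lt_max_of_lt_right (by norm_num)).ne'
  have h1 : Continuous fun x : Fin k → ℝ => min 1 (3 * (1 - ‖x‖)) := by fun_prop
  have h2 : Continuous fun x : Fin k → ℝ => max ‖x‖ (1 / 3) := by fun_prop
  exact continuous_cons (by fun_prop) ((h1.div h2 hne).smul continuous_id)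

/-- The inner third of the radius is sent to the bottom face of the sphere, the middle third to the
side and the outer third to the top face, with the boundary going to the center `pole k` of the
latter. -/
lemma theta_of_le {x : Fin k → ℝ} (h : ‖x‖ ≤ 1 / 3) : theta x = Fin.cons (-1) ((3 : ℝ) • x) := by
  rw [theta, max_eq_right h, min_eq_left (a := (1 : ℝ)) (b := 3 * (1 - ‖x‖)) (by linarith),
    min_eq_right (by linarith), max_eq_left (by linarith)]
  norm_num

lemma theta_of_mem {x : Fin k → ℝ} (h : 1 / 3 ≤ ‖x‖) (h' : ‖x‖ ≤ 2 / 3) :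
    theta x = Fin.cons (6 * ‖x‖ - 3) (‖x‖⁻¹ • x) := by
  rw [theta, max_eq_left h, min_eq_left (a := (1 : ℝ)) (b := 3 * (1 - ‖x‖)) (by linarith),
    min_eq_right (by linarith), max_eq_right (by linarith), one_div]

lemma theta_of_ge {x : Fin k → ℝ} (h : 2 / 3 ≤ ‖x‖) :
    theta x = Fin.cons 1 ((3 * (1 - ‖x‖) / ‖x‖) • x) := by
  rw [theta, max_eq_left (by linarith : (1 : ℝ) / 3 ≤ ‖x‖),
    min_eq_right (a := (1 : ℝ)) (b := 3 * (1 - ‖x‖)) (by linarith),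
    min_eq_left (by linarith), max_eq_right (by linarith)]

lemma theta_of_norm_eq_one {x : Fin k → ℝ} (h : ‖x‖ = 1) : theta x = pole k := by
  rw [theta_of_ge (by rw [h]; norm_num), h, pole]
  simp

lemma norm_theta {x : Fin k → ℝ} (h : ‖x‖ ≤ 1) : ‖theta x‖ = 1 := by
  rcases le_total ‖x‖ (1 / 3) with h1 | h1
  · rw [theta_of_le h1, norm_cons, norm_smul]
    simp only [abs_neg, abs_one, Real.norm_ofNat]
    exact max_eq_left (by linarith)
  rcases le_total ‖x‖ (2 / 3) with h2 | h2
  · rw [theta_of_mem h1 h2, norm_cons, norm_smul, norm_inv, norm_norm,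
      inv_mul_cancel₀ (by linarith)]
    exact max_eq_right (abs_le.2 ⟨by linarith, by linarith⟩)
  · have : 0 < ‖x‖ := by linarith
    rw [theta_of_ge h2, norm_cons, norm_smul, Real.norm_of_nonneg (div_nonneg (by linarith) this.le),
      div_mul_cancel₀ _ this.ne', abs_one]
    exact max_eq_left (by linarith)

lemma theta_cubeToBall_mem (s : Fin k → I) :
    theta (cubeToBall s) ∈ sphere (0 : Fin (k + 1) → ℝ) 1 := by
  rw [mem_sphere_zero_iff_norm]
  exact norm_theta (by simpa using cubeToBall_mem s)

lemma exists_theta_eq [Nonempty (Fin k)] {y : Fin (k + 1) → ℝ} (hy : ‖y‖ = 1) :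
    ∃ x : Fin k → ℝ, ‖x‖ ≤ 1 ∧ theta x = y := by
  have hn := hy
  rw [← Fin.cons_self_tail y, norm_cons] at hn
  set z := y 0
  set w := Fin.tail y
  have hyzw : y = Fin.cons z w := (Fin.cons_self_tail y).symm
  have hz : |z| ≤ 1 := hn ▸ le_max_left _ _
  have hw : ‖w‖ ≤ 1 := hn ▸ le_max_right _ _
  have hz' := abs_le.1 hz
  by_cases hw1 : ‖w‖ = 1
  · have hc : 0 < (z + 3) / 6 := by linarith
    have hx : ‖((z + 3) / 6) • w‖ = (z + 3) / 6 := by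
      rw [norm_smul, hw1, mul_one, Real.norm_of_nonneg hc.le]
    refine ⟨((z + 3) / 6) • w, by rw [hx]; linarith, ?_⟩
    rw [theta_of_mem (by rw [hx]; linarith) (by rw [hx]; linarith), hx, smul_smul,
      inv_mul_cancel₀ hc.ne', one_smul, hyzw]
    congr 1
    ring
  have hz1 : |z| = 1 := by
    rcases max_choice |z| ‖w‖ with h | h
    · exact h ▸ hn
    · exact absurd (h ▸ hn) hw1
  rcases eq_or_eq_neg_of_abs_eq hz1 with h | h
  · by_cases hw0 : w = 0
    -- The pole comes from any boundary point; this vector has norm one only because `Fin k` is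
    -- nonempty.
    · refine ⟨fun _ => 1, by simp, ?_⟩
      rw [theta_of_norm_eq_one (by simp), hyzw, hw0, h]
      rfl
    · have hwp : 0 < ‖w‖ := norm_pos_iff.2 hw0
      have hx : ‖((1 - ‖w‖ / 3) / ‖w‖) • w‖ = 1 - ‖w‖ / 3 := by
        rw [norm_smul, Real.norm_of_nonneg (div_nonneg (by linarith) hwp.le),
          div_mul_cancel₀ _ hwp.ne']
      refine ⟨((1 - ‖w‖ / 3) / ‖w‖) • w, by rw [hx]; linarith, ?_⟩
      rw [theta_of_ge (by rw [hx]; linarith), hx, smul_smul, hyzw, h]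
      congr 1
      have : 1 - ‖w‖ / 3 ≠ 0 := by linarith
      rw [div_mul_div_comm, mul_comm (1 - ‖w‖ / 3) ‖w‖, mul_div_mul_right _ _ this]
      rw [show 3 * (1 - (1 - ‖w‖ / 3)) = ‖w‖ by ring, div_self hwp.ne', one_smul]
  · refine ⟨(1 / 3 : ℝ) • w, ?_, ?_⟩
    · rw [norm_smul]; norm_num; linarith
    · rw [theta_of_le (by rw [norm_smul]; norm_num; linarith), smul_smul, hyzw, h]
      norm_num

/-- The clamped first coordinate tells in which third of the radius the point lies. There the norm
and the tail determine the point, unless the scalar in front of the tail vanishes, which happens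
only on the boundary. -/
lemma eq_or_norm_eq_one_of_theta_eq {x x' : Fin k → ℝ} (hx : ‖x‖ ≤ 1) (hx' : ‖x'‖ ≤ 1)
    (h : theta x = theta x') : x = x' ∨ (‖x‖ = 1 ∧ ‖x'‖ = 1) := by
  have h0 : max (-1) (min 1 (6 * ‖x‖ - 3)) = max (-1) (min 1 (6 * ‖x'‖ - 3)) := by
    simpa [theta] using congrFun h 0
  have clamp_le : ∀ r : ℝ, r ≤ 1 / 3 → max (-1) (min 1 (6 * r - 3)) = -1 := fun r hr => by
    rw [min_eq_right (by linarith), max_eq_left (by linarith)]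
  have clamp_mid : ∀ r : ℝ, 1 / 3 ≤ r → r ≤ 2 / 3 → max (-1) (min 1 (6 * r - 3)) = 6 * r - 3 :=
    fun r hr hr' => by rw [min_eq_right (by linarith), max_eq_right (by linarith)]
  have clamp_ge : ∀ r : ℝ, 2 / 3 ≤ r → max (-1) (min 1 (6 * r - 3)) = 1 := fun r hr => by
    rw [min_eq_left (by linarith), max_eq_right (by linarith)]
  have tails : ∀ {c c' : ℝ} {w w' : Fin k → ℝ},
      (Fin.cons c w : Fin (k + 1) → ℝ) = Fin.cons c' w' → w = w' := fun h => (Fin.cons_inj.1 h).2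
  rcases le_total ‖x‖ (1 / 3) with h1 | h1
  · have h1' : ‖x'‖ ≤ 1 / 3 := by
      rw [clamp_le _ h1] at h0
      by_contra! hc
      rcases le_total ‖x'‖ (2 / 3) with h2 | h2
      · rw [clamp_mid _ hc.le h2] at h0; linarith
      · rw [clamp_ge _ h2] at h0; linarith
    rw [theta_of_le h1, theta_of_le h1'] at h
    exact .inl (smul_right_injective _ (three_ne_zero (α := ℝ)) (tails h))
  rcases le_total ‖x‖ (2 / 3) with h2 | h2
  · rw [clamp_mid _ h1 h2] at h0
    have hr : ‖x'‖ = ‖x‖ := by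
      rcases le_total ‖x'‖ (1 / 3) with h3 | h3
      · rw [clamp_le _ h3] at h0
        have h4 : ‖x‖ = 1 / 3 := by linarith
        have := h
        rw [theta_of_mem h1 h2, theta_of_le h3] at this
        have := congrArg norm (tails this)
        rw [norm_smul, norm_smul, norm_inv, norm_norm, inv_mul_cancel₀ (by linarith)] at this
        norm_num at this
        linarith
      rcases le_total ‖x'‖ (2 / 3) with h4 | h4
      · rw [clamp_mid _ h3 h4] at h0; linarith
      · rw [clamp_ge _ h4] at h0
        have := h
        rw [theta_of_mem h1 h2, theta_of_ge h4] at this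
        have := congrArg norm (tails this)
        rw [norm_smul, norm_smul, norm_inv, norm_norm, inv_mul_cancel₀ (by linarith),
          Real.norm_of_nonneg (div_nonneg (by linarith) (by linarith)),
          div_mul_cancel₀ _ (by linarith)] at this
        linarith
    rw [theta_of_mem h1 h2, theta_of_mem (by rwa [hr]) (by rwa [hr]), hr] at h
    exact .inl (smul_right_injective _ (inv_ne_zero (by linarith : ‖x‖ ≠ 0)) (tails h))
  · rw [clamp_ge _ h2] at h0
    have h2' : 2 / 3 ≤ ‖x'‖ := by
      by_contra! hc
      rcases le_total ‖x'‖ (1 / 3) with h3 | h3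
      · rw [clamp_le _ h3] at h0; linarith
      · rw [clamp_mid _ h3 hc.le] at h0; linarith
    rw [theta_of_ge h2, theta_of_ge h2'] at h
    have ht := tails h
    have hn := congrArg norm ht
    rw [norm_smul, norm_smul, Real.norm_of_nonneg (div_nonneg (by linarith) (by linarith)),
      Real.norm_of_nonneg (div_nonneg (by linarith) (by linarith)),
      div_mul_cancel₀ _ (by linarith), div_mul_cancel₀ _ (by linarith)] at hn
    have hr : ‖x'‖ = ‖x‖ := by linarith
    by_cases h1 : ‖x‖ = 1
    · exact .inr ⟨h1, hr.trans h1⟩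
    · rw [hr] at ht
      refine .inl (smul_right_injective _ (div_ne_zero ?_ (by linarith : ‖x‖ ≠ 0)) ht)
      intro h3
      exact h1 (by linarith)

end Theta

/-! ### Extending maps from spheres to balls by means of vanishing homotopy groups. -/

section SphereExtension

variable {k : ℕ} {Y : Type*} [TopologicalSpace Y] {y y' : Y}

/-- Every continuous map to `Y` from the unit sphere in dimension `m` extends over the ball. -/
def ExtendsOverBall (Y : Type*) [TopologicalSpace Y] (m : ℕ) : Prop :=
  ∀ u : (Fin m → ℝ) → Y, ContinuousOn u (sphere 0 1) →
    ∃ v, ContinuousOn v (closedBall 0 1) ∧ EqOn v u (sphere 0 1)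

/-- The map sending `(t, s)` to `(1 - t) • theta (cubeToBall s)` is a quotient map from the compact
cylinder onto the ball. It only identifies boundary points at equal times and all points at time 1,
where the homotopy takes equal values, so the homotopy descends to the ball. -/
theorem exists_ball_extension_of_drag [Nonempty (Fin k)] {u : (Fin (k + 1) → ℝ) → Y}
    {a : C(Fin k → I, Y)} (ha : ∀ s, a s = u (theta (cubeToBall s)))
    {γ : Path y y'} (h : Drag γ a (ContinuousMap.const _ y')) :
    ∃ v, ContinuousOn v (closedBall 0 1) ∧ EqOn v u (sphere 0 1) := by
  obtain ⟨H, hH⟩ := h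
  have : Nonempty Y := ⟨y⟩
  let B := closedBall (0 : Fin (k + 1) → ℝ) 1
  have hnorm : ∀ p : I × (Fin k → I), ‖(1 - (p.1 : ℝ)) • theta (cubeToBall p.2)‖ = 1 - p.1 := by
    intro p
    rw [norm_smul, norm_theta (by simpa using cubeToBall_mem p.2), mul_one,
      Real.norm_of_nonneg (by linarith [p.1.2.2])]
  let Ψ : C(I × (Fin k → I), B) := ⟨fun p => ⟨(1 - (p.1 : ℝ)) • theta (cubeToBall p.2), by
    rw [mem_closedBall_zero_iff, hnorm]; linarith [p.1.2.1]⟩, by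
    have := continuous_theta (k := k)
    fun_prop⟩
  have hsurj : Function.Surjective Ψ := by
    rintro ⟨z, hz⟩
    by_cases hz0 : z = 0
    · exact ⟨(1, 0), Subtype.ext (by simp [Ψ, hz0])⟩
    · have hp : 0 < ‖z‖ := norm_pos_iff.2 hz0
      have hz1 : ‖z‖ ≤ 1 := by simpa [B] using hz
      obtain ⟨x, hx, hxz⟩ := exists_theta_eq (y := ‖z‖⁻¹ • z) (by
        rw [norm_smul, norm_inv, norm_norm, inv_mul_cancel₀ hp.ne'])
      refine ⟨(⟨1 - ‖z‖, by linarith, by linarith⟩, ballToCube x), Subtype.ext ?_⟩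
      simp only [Ψ, ContinuousMap.coe_mk]
      rw [cubeToBall_ballToCube (by simpa using hx), hxz, smul_smul, sub_sub_cancel,
        mul_inv_cancel₀ hp.ne', one_smul]
  have hq : Topology.IsQuotientMap Ψ := .of_surjective_continuous hsurj Ψ.continuous
  have hfac : Function.FactorsThrough H.toContinuousMap Ψ := by
    intro p p' hpp
    have hv : (1 - (p.1 : ℝ)) • theta (cubeToBall p.2) =
      (1 - (p'.1 : ℝ)) • theta (cubeToBall p'.2) := congrArg Subtype.val hpp
    have ht : (p.1 : ℝ) = p'.1 := by
      have := congrArg norm hv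
      rw [hnorm, hnorm] at this
      linarith
    obtain ⟨t, s⟩ := p
    obtain ⟨t', s'⟩ := p'
    obtain rfl : t = t' := Subtype.ext ht
    change H (t, s) = H (t, s')
    by_cases h1 : t = 1
    · rw [h1, H.apply_one, H.apply_one]; rfl
    · have hne : 1 - (t : ℝ) ≠ 0 := fun h => h1 (Subtype.ext (by rw [Icc.coe_one]; linarith))
      have hth := smul_right_injective _ hne hv
      rcases eq_or_norm_eq_one_of_theta_eq (by simpa using cubeToBall_mem s)
        (by simpa using cubeToBall_mem s') hth with h | h
      · have : s = s' := by rw [← ballToCube_cubeToBall s, h, ballToCube_cubeToBall]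
        rw [this]
      · rw [hH t s ((mem_boundary_iff s).2 h.1), hH t s' ((mem_boundary_iff s').2 h.2)]
  obtain ⟨v, hv, hv'⟩ := exists_continuousOn_extension (hq.lift H.toContinuousMap hfac).continuous
  refine ⟨v, hv, fun z hz => ?_⟩
  obtain ⟨x, hx, rfl⟩ := exists_theta_eq (y := z) (by simpa using hz)
  have hx' : x ∈ closedBall (0 : Fin k → ℝ) 1 := by simpa using hx
  have hΨ : Ψ (0, ballToCube x) = ⟨theta x, sphere_subset_closedBall hz⟩ := by
    refine Subtype.ext ?_
    simp [Ψ, cubeToBall_ballToCube hx']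
  rw [hv' _ (sphere_subset_closedBall hz), ← hΨ]
  have := DFunLike.congr_fun (hq.lift_comp H.toContinuousMap hfac) (0, ballToCube x)
  refine this.trans ?_
  change H (0, _) = _
  rw [H.apply_zero, ha, cubeToBall_ballToCube hx']

/-- The ball is contracted along straight lines to the pole, and the boundary of the cube sits at
the pole throughout. -/
lemma drag_of_ball_extension {R : (Fin (k + 1) → ℝ) → Y} (hR : ContinuousOn R (closedBall 0 1))
    {a : C(Fin k → I, Y)} (ha : ∀ s, a s = R (theta (cubeToBall s))) :
    Drag (Path.refl (R (pole k))) a (ContinuousMap.const _ (R (pole k))) := by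
  have hpole : pole k ∈ closedBall (0 : Fin (k + 1) → ℝ) 1 := by
    rw [mem_closedBall_zero_iff, pole, norm_cons]; simp
  have hth := continuous_theta (k := k)
  refine ⟨⟨⟨fun p => R ((1 - (p.1 : ℝ)) • theta (cubeToBall p.2) + (p.1 : ℝ) • pole k),
    hR.comp_continuous (by fun_prop) fun p => ?_⟩, fun s => ?_, fun s => ?_⟩, fun t s hs => ?_⟩
  · exact convex_closedBall _ _ (sphere_subset_closedBall (theta_cubeToBall_mem p.2)) hpole
      (by linarith [p.1.2.2]) p.1.2.1 (by ring)
  · simp [ha]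
  · simp
  · change R _ = R _
    rw [theta_of_norm_eq_one ((mem_boundary_iff s).1 hs), ← add_smul]
    simp

open Topology.Homotopy in
-- Composed with `theta`, the map becomes a cube with constant boundary; dragged to `y₀` it is a
-- generalized loop, hence null-homotopic. For `k = 0` the sphere consists of two points and a path
-- joins their images.
theorem extendsOverBall_of_subsingleton [PathConnectedSpace Y] (y₀ : Y)
    (h : Subsingleton (HomotopyGroup (Fin k) Y y₀)) : ExtendsOverBall Y (k + 1) := by
  intro u hu
  rcases k.eq_zero_or_pos with rfl | hk
  · let γ : Path (u fun _ => -1) (u fun _ => 1) := (PathConnectedSpace.joined _ _).somePath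
    refine ⟨fun x => γ (projIcc 0 1 zero_le_one ((x 0 + 1) / 2)),
      (γ.continuous.comp (continuous_projIcc.comp (by fun_prop))).continuousOn, fun x hx => ?_⟩
    obtain ⟨i, hi⟩ := (norm_eq_one_iff (sphere_subset_closedBall hx)).1 (by simpa using hx)
    obtain rfl : i = 0 := Fin.fin_one_eq_zero i
    have hx' : ∀ c, x 0 = c → x = fun _ => c := fun c hc => by
      funext j; rw [Fin.fin_one_eq_zero j, ← hc]
    rcases hi with hi | hi
    · beta_reduce
      rw [hi, hx' _ hi]; simp
    · beta_reduce
      rw [hi, hx' _ hi]; norm_num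
  · have : Nonempty (Fin k) := ⟨⟨0, hk⟩⟩
    let a : C(Fin k → I, Y) := ⟨fun s => u (theta (cubeToBall s)),
      hu.comp_continuous (continuous_theta.comp continuous_cubeToBall) theta_cubeToBall_mem⟩
    let γ : Path (u (pole k)) y₀ := (PathConnectedSpace.joined _ _).somePath
    obtain ⟨b, hb, hab⟩ := exists_drag γ a fun s hs => by
      change u _ = _
      rw [theta_of_norm_eq_one ((mem_boundary_iff s).1 hs)]
    have hnull : b.HomotopicRel (ContinuousMap.const _ y₀) (Cube.boundary (Fin k)) :=
      piClass_eq_iff.1 (Subsingleton.elim (piClass (⟨b, hb⟩ : Ω^ (Fin k) Y y₀))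
        (piClass GenLoop.const))
    exact exists_ball_extension_of_drag (fun _ => rfl)
      (hab.trans (Drag.of_homotopicRel hnull hb))

/-- Two maps on the ball together with a homotopy on the sphere between their restrictions extend
to a homotopy. -/
theorem ExtendsOverBall.exists_homotopy (h : ExtendsOverBall Y (k + 1))
    {u : (Fin k → ℝ) → C(I, Y)} {v₀ v₁ : (Fin k → ℝ) → Y} (hu : ContinuousOn u (sphere 0 1))
    (hv₀ : ContinuousOn v₀ (closedBall 0 1)) (hv₁ : ContinuousOn v₁ (closedBall 0 1))
    (h₀ : ∀ x ∈ sphere (0 : Fin k → ℝ) 1, u x 0 = v₀ x)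
    (h₁ : ∀ x ∈ sphere (0 : Fin k → ℝ) 1, u x 1 = v₁ x) :
    ∃ w : (Fin k → ℝ) → C(I, Y), ContinuousOn w (closedBall 0 1) ∧ EqOn w u (sphere 0 1) ∧
      ∀ x ∈ closedBall (0 : Fin k → ℝ) 1, w x 0 = v₀ x ∧ w x 1 = v₁ x := by
  have : Nonempty C(I, Y) := ⟨u 0⟩
  obtain ⟨U, hU, hU0, hU1, hUs⟩ := exists_sphere_glue (B := fun t x => u x t) hv₀ hv₁
    (continuous_eval.comp_continuousOn ((hu.comp continuousOn_snd fun p hp => hp.2).prodMk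
      continuousOn_fst)) h₀ h₁
  obtain ⟨W, hW, hWU⟩ := h U hU
  let G : C(closedBall (0 : Fin k → ℝ) 1 × I, Y) :=
    ⟨fun p => W (Fin.cons (2 * (p.2 : ℝ) - 1) p.1.1), hW.comp_continuous (by fun_prop) fun p => by
      have hp := p.1.2
      rw [mem_closedBall_zero_iff] at hp ⊢
      rw [norm_cons, max_le_iff, abs_le]
      have h1 := p.2.2.1
      have h2 := p.2.2.2
      exact ⟨⟨by linarith, by linarith⟩, hp⟩⟩
  obtain ⟨w, hw, hw'⟩ := exists_continuousOn_extension G.curry.continuous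
  have hend : ∀ c : ℝ, |c| = 1 → ∀ x ∈ closedBall (0 : Fin k → ℝ) 1,
      (Fin.cons c x : Fin (k + 1) → ℝ) ∈ sphere (0 : Fin (k + 1) → ℝ) 1 := by
    intro c hc x hx
    rw [mem_sphere_zero_iff_norm, norm_cons, hc]
    exact max_eq_left (by simpa using hx)
  refine ⟨w, hw, fun x hx => ?_, fun x hx => ⟨?_, ?_⟩⟩
  · rw [hw' x (sphere_subset_closedBall hx)]
    ext t
    change W (Fin.cons (2 * (t : ℝ) - 1) x) = _
    rw [hWU, hUs t x hx]
    rw [mem_sphere_zero_iff_norm] at hx ⊢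
    rw [norm_cons, hx]
    refine max_eq_right (abs_le.2 ?_)
    have h1 := t.2.1
    have h2 := t.2.2
    exact ⟨by linarith, by linarith⟩
  · rw [hw' x hx]
    change W (Fin.cons (2 * ((0 : I) : ℝ) - 1) x) = _
    rw [show 2 * ((0 : I) : ℝ) - 1 = -1 by norm_num, hWU (hend _ (by norm_num) x hx), hU0 x hx]
  · rw [hw' x hx]
    change W (Fin.cons (2 * ((1 : I) : ℝ) - 1) x) = _
    rw [show 2 * ((1 : I) : ℝ) - 1 = 1 by norm_num, hWU (hend _ (by norm_num) x hx), hU1 x hx]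

end SphereExtension

/-! ### Cells, skeleta and the weak topology. -/

section Cells

variable (X : Type*) [TopologicalSpace X] [T2Space X] [Topology.CWComplex (Set.univ : Set X)]

/-- The cells of dimension `k` of a CW complex `X`. -/
abbrev Cell (k : ℕ) := Topology.RelCWComplex.cell (Set.univ : Set X) k

/-- The union of all cells of dimension less than `k`. -/
def skel (k : ℕ) : Set X := Topology.RelCWComplex.skeletonLT (Set.univ : Set X) k

variable {X} {k : ℕ}

/-- The characteristic map of a cell. -/
def chi (e : Cell X k) : (Fin k → ℝ) → X := Topology.RelCWComplex.map (C := Set.univ) k e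

/-- The inverse of the characteristic map on the open cell. -/
def chiInv (e : Cell X k) : X → (Fin k → ℝ) := (Topology.RelCWComplex.map (C := Set.univ) k e).symm

/-- The open cell. -/
abbrev oCell (e : Cell X k) : Set X := Topology.RelCWComplex.openCell (C := Set.univ) k e

lemma continuousOn_chi (e : Cell X k) : ContinuousOn (chi e) (closedBall 0 1) :=
  Topology.RelCWComplex.continuousOn k e

lemma chi_mem_oCell (e : Cell X k) {y : Fin k → ℝ} (hy : y ∈ ball (0 : Fin k → ℝ) 1) :
    chi e y ∈ oCell e := mem_image_of_mem _ hy

lemma chiInv_chi (e : Cell X k) {y : Fin k → ℝ} (hy : y ∈ ball (0 : Fin k → ℝ) 1) :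
    chiInv e (chi e y) = y :=
  (Topology.RelCWComplex.map (C := Set.univ) k e).left_inv
    (by rwa [Topology.RelCWComplex.source_eq])

lemma chi_chiInv (e : Cell X k) {x : X} (hx : x ∈ oCell e) : chi e (chiInv e x) = x := by
  obtain ⟨y, hy, rfl⟩ := hx
  change chi e (chiInv e (chi e y)) = chi e y
  rw [chiInv_chi e hy]

lemma chiInv_mem (e : Cell X k) {x : X} (hx : x ∈ oCell e) :
    chiInv e x ∈ ball (0 : Fin k → ℝ) 1 := by
  obtain ⟨y, hy, rfl⟩ := hx
  change chiInv e (chi e y) ∈ _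
  rwa [chiInv_chi e hy]

lemma continuousOn_chiInv (e : Cell X k) : ContinuousOn (chiInv e) (oCell e) := by
  have h := Topology.RelCWComplex.continuousOn_symm k e
  rwa [← PartialEquiv.image_source_eq_target, Topology.RelCWComplex.source_eq] at h

lemma eq_of_mem_oCell {m : ℕ} {e : Cell X k} {e' : Cell X m} {x : X} (h : x ∈ oCell e)
    (h' : x ∈ oCell e') : (⟨k, e⟩ : Σ n, Cell X n) = ⟨m, e'⟩ :=
  Topology.RelCWComplex.eq_of_not_disjoint_openCell (not_disjoint_iff.2 ⟨x, h, h'⟩)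

lemma mem_skel_iff {x : X} : x ∈ skel X k ↔ ∃ m < k, ∃ e : Cell X m, x ∈ oCell e := by
  have h := Topology.CWComplex.iUnion_openCell_eq_skeletonLT (C := (Set.univ : Set X)) k
  rw [skel, ← h]
  simp

lemma exists_mem_oCell (x : X) : ∃ (m : ℕ) (e : Cell X m), x ∈ oCell e := by
  have h := Topology.CWComplex.iUnion_openCell_eq_skeletonLT (C := (Set.univ : Set X)) ⊤
  rw [Topology.RelCWComplex.skeletonLT_top] at h
  simpa using h.symm.subset (mem_univ x)

lemma notMem_skel_of_mem_oCell {e : Cell X k} {x : X} (h : x ∈ oCell e) : x ∉ skel X k := by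
  intro h'
  obtain ⟨m, hm, e', he'⟩ := mem_skel_iff.1 h'
  have := congrArg Sigma.fst (eq_of_mem_oCell h he')
  simp only at this
  lia

lemma skel_mono {k m : ℕ} (h : k ≤ m) : skel X k ⊆ skel X m :=
  Topology.RelCWComplex.skeletonLT_mono (by exact_mod_cast h)

lemma isClosed_skel : IsClosed (skel X k) :=
  Topology.RelCWComplex.Subcomplex.closed _

lemma chi_mem_skel_of_sphere (e : Cell X k) {y : Fin k → ℝ} (hy : y ∈ sphere (0 : Fin k → ℝ) 1) :
    chi e y ∈ skel X k :=
  Topology.RelCWComplex.cellFrontier_subset_skeletonLT k e (mem_image_of_mem _ hy)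

lemma chi_mem_skel (e : Cell X k) {y : Fin k → ℝ} (hy : y ∈ closedBall (0 : Fin k → ℝ) 1) :
    chi e y ∈ skel X (k + 1) := by
  have := Topology.RelCWComplex.closedCell_subset_skeletonLT k e (mem_image_of_mem _ hy)
  exact_mod_cast this

lemma mem_skel_succ_iff {x : X} : x ∈ skel X (k + 1) ↔ x ∈ skel X k ∨ ∃ e : Cell X k, x ∈ oCell e := by
  rw [mem_skel_iff, mem_skel_iff]
  constructor
  · rintro ⟨m, hm, e, he⟩
    rcases Nat.lt_succ_iff_lt_or_eq.1 hm with h | rfl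
    · exact .inl ⟨m, h, e, he⟩
    · exact .inr ⟨e, he⟩
  · rintro (⟨m, hm, e, he⟩ | ⟨e, he⟩)
    · exact ⟨m, by lia, e, he⟩
    · exact ⟨k, by lia, e, he⟩

lemma mem_ball_or_sphere {y : Fin k → ℝ} (hy : y ∈ closedBall (0 : Fin k → ℝ) 1) :
    y ∈ ball (0 : Fin k → ℝ) 1 ∨ y ∈ sphere (0 : Fin k → ℝ) 1 := by
  have := (ball_union_sphere (x := (0 : Fin k → ℝ)) (ε := 1)).symm.subset hy
  exact this

lemma iUnion_skel : ∀ x : X, ∃ k, x ∈ skel X k := fun x => by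
  obtain ⟨m, e, he⟩ := exists_mem_oCell x
  exact ⟨m + 1, mem_skel_iff.2 ⟨m, by lia, e, he⟩⟩

variable {Z : Type*} [TopologicalSpace Z]

/-- The weak topology on a skeleton. -/
lemma isClosed_of_inter_cells {A : Set X} (hA : A ⊆ skel X k)
    (h : ∀ m < k, ∀ e : Cell X m, IsClosed (A ∩ chi e '' closedBall 0 1)) : IsClosed A := by
  refine Topology.CWComplex.isClosed_of_disjoint_openCell_or_isClosed_inter_closedCell
    (C := (Set.univ : Set X)) (subset_univ _) fun m _ e => ?_
  by_cases hm : m < k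
  · exact .inr (h m hm e)
  · refine .inl (Set.disjoint_left.2 fun x hx hxe => ?_)
    exact notMem_skel_of_mem_oCell hxe (skel_mono (by lia) (hA hx))

/-- A closed set pulls back to a compact subset of each ball, whose image in the cell is closed; the
weak topology then applies. -/
lemma continuousOn_skel {f : X → Z}
    (h : ∀ m < k, ∀ e : Cell X m, ContinuousOn (fun y => f (chi e y)) (closedBall 0 1)) :
    ContinuousOn f (skel X k) := by
  rw [continuousOn_iff_isClosed]
  intro t ht
  refine ⟨f ⁻¹' t ∩ skel X k, ?_, by rw [inter_assoc, inter_self]⟩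
  refine isClosed_of_inter_cells inter_subset_right fun m hm e => ?_
  have hsub : chi e '' closedBall 0 1 ⊆ skel X k := by
    rintro _ ⟨y, hy, rfl⟩
    exact skel_mono (by lia) (chi_mem_skel e hy)
  have : f ⁻¹' t ∩ skel X k ∩ chi e '' closedBall 0 1 =
      chi e '' (closedBall 0 1 ∩ (fun y => f (chi e y)) ⁻¹' t) := by
    ext x
    constructor
    · rintro ⟨⟨h1, _⟩, ⟨y, hy, rfl⟩⟩
      exact ⟨y, ⟨hy, h1⟩, rfl⟩
    · rintro ⟨y, ⟨hy, h1⟩, rfl⟩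
      exact ⟨⟨h1, hsub ⟨y, hy, rfl⟩⟩, ⟨y, hy, rfl⟩⟩
  rw [this]
  have hcl := (h m hm e).preimage_isClosed_of_isClosed isClosed_closedBall ht
  have hcomp : IsCompact (closedBall (0 : Fin m → ℝ) 1 ∩ (fun y => f (chi e y)) ⁻¹' t) :=
    (isCompact_closedBall _ _).of_isClosed_subset hcl inter_subset_left
  exact (hcomp.image_of_continuousOn ((continuousOn_chi e).mono inter_subset_left)).isClosed

/-- Currying reduces the product to the criterion for a single complex, with values in `C(T, Z)`.
Local compactness of `T` makes evaluation continuous, which allows uncurrying. -/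
lemma continuousOn_skel_prod {T : Type*} [TopologicalSpace T] [LocallyCompactSpace T]
    {F : T → X → Z}
    (h : ∀ m < k, ∀ e : Cell X m,
      ContinuousOn (fun p : T × (Fin m → ℝ) => F p.1 (chi e p.2)) (univ ×ˢ closedBall 0 1)) :
    ContinuousOn (fun p : T × X => F p.1 p.2) (univ ×ˢ skel X k) := by
  rcases isEmpty_or_nonempty T with hT | ⟨⟨t₀⟩⟩
  · exact fun p => hT.elim p.1
  rcases (skel X k).eq_empty_or_nonempty with hX | ⟨x₀, hx₀⟩
  · rw [hX, prod_empty]; exact continuousOn_empty _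
  have hcont : ∀ x ∈ skel X k, Continuous fun t => F t x := by
    intro x hx
    obtain ⟨m, hm, e, he⟩ := mem_skel_iff.1 hx
    obtain ⟨y, hy, rfl⟩ := he
    exact (h m hm e).comp_continuous (f := fun t => (t, y)) (by fun_prop)
      fun t => ⟨mem_univ _, ball_subset_closedBall hy⟩
  classical
  let G : X → C(T, Z) := fun x => if hx : x ∈ skel X k then ⟨_, hcont x hx⟩ else ⟨_, hcont x₀ hx₀⟩
  have hG : ContinuousOn G (skel X k) := by
    refine continuousOn_skel fun m hm e => ?_
    rw [continuousOn_iff_continuous_domRestrict]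
    refine ContinuousMap.continuous_of_continuous_uncurry _ ?_
    have := (h m hm e).comp_continuous
      (f := fun p : closedBall (0 : Fin m → ℝ) 1 × T => (p.2, p.1.1)) (by fun_prop)
      fun p => ⟨mem_univ _, p.1.2⟩
    convert this using 1
    funext p
    have hp : chi e p.1.1 ∈ skel X k := skel_mono (by lia) (chi_mem_skel e p.1.2)
    simp [Function.uncurry, G, hp]
  refine ContinuousOn.congr (f := fun p : T × X => G p.2 p.1) ?_ ?_
  · exact continuous_eval.comp_continuousOn
      ((hG.comp continuousOn_snd fun p hp => hp.2).prodMk continuousOn_fst)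
  · intro p hp
    simp [G, hp.2]

lemma continuous_of_cells {f : X → Z}
    (h : ∀ m, ∀ e : Cell X m, ContinuousOn (fun y => f (chi e y)) (closedBall 0 1)) :
    Continuous f := by
  rw [continuous_iff_isClosed]
  intro t ht
  refine Topology.CWComplex.isClosed_of_disjoint_openCell_or_isClosed_inter_closedCell
    (C := (Set.univ : Set X)) (subset_univ _) fun m _ e => .inr ?_
  have h1 := (continuousOn_skel (k := m + 1) fun m _ e => h m e).preimage_isClosed_of_isClosed
    isClosed_skel ht
  have h2 := h1.inter (Topology.RelCWComplex.isClosed_closedCell (C := (Set.univ : Set X)) (i := e))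
  convert h2 using 1
  ext x
  constructor
  · rintro ⟨hx, hxe⟩
    refine ⟨⟨?_, hx⟩, hxe⟩
    obtain ⟨y, hy, rfl⟩ := hxe
    exact chi_mem_skel e hy
  · rintro ⟨⟨_, hx⟩, hxe⟩
    exact ⟨hx, hxe⟩

/-- A compact subset of a CW complex lies in a skeleton. -/
lemma exists_subset_skel_of_isCompact {K : Set X} (hK : IsCompact K) : ∃ k, K ⊆ skel X k := by
  by_contra! hc
  choose x hxK hx using fun k => not_subset.1 (hc k)
  -- Each tail of the sequence meets every closed cell in a finite set, so it is closed. By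
  -- compactness the tails have a common point, but that point lies in some skeleton, which later
  -- terms avoid.
  let S : ℕ → Set X := fun n => x '' {m | n ≤ m}
  have hcl : ∀ n, IsClosed (S n) := by
    intro n
    refine Topology.CWComplex.isClosed_of_disjoint_openCell_or_isClosed_inter_closedCell
      (C := (Set.univ : Set X)) (subset_univ _) fun m _ e => .inr ?_
    refine Set.Finite.isClosed (((finite_le_nat m).image x).subset ?_)
    rintro _ ⟨⟨j, _, rfl⟩, ⟨y, hy, hyx⟩⟩
    refine ⟨j, ?_, rfl⟩
    by_contra! hj
    refine hx j (skel_mono (k := m + 1) ?_ (hyx ▸ chi_mem_skel e hy))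
    simp only [mem_ofPred_eq, not_le] at hj
    exact hj
  obtain ⟨z, hz⟩ := IsCompact.nonempty_iInter_of_sequence_nonempty_isCompact_isClosed S
    (fun n => image_mono fun m hm => by simp only [mem_ofPred_eq] at hm ⊢; lia)
    (fun n => ⟨x n, n, le_refl n, rfl⟩)
    (hK.of_isClosed_subset (hcl 0) (by rintro _ ⟨j, _, rfl⟩; exact hxK j)) hcl
  obtain ⟨k, hk⟩ := iUnion_skel z
  obtain ⟨j, hj, hjz⟩ := mem_iInter.1 hz k
  exact hx j (skel_mono hj (hjz ▸ hk))

end Cells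

/-! ### Constructing maps cell by cell. -/

section Modify

variable {X : Type*} [TopologicalSpace X] [T2Space X] [Topology.CWComplex (Set.univ : Set X)]
  {k : ℕ} {E : Type*}

open Classical in
/-- Replace a function on the open cells of dimension `k`. -/
noncomputable def modify (u : Cell X k → (Fin k → ℝ) → E) (g : X → E) (x : X) : E :=
  if h : ∃ e : Cell X k, x ∈ oCell e then u h.choose (chiInv h.choose x) else g x

variable {u : Cell X k → (Fin k → ℝ) → E} {g : X → E}

lemma modify_of_mem_oCell {e : Cell X k} {x : X} (hx : x ∈ oCell e) :
    modify u g x = u e (chiInv e x) := by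
  have h : ∃ e : Cell X k, x ∈ oCell e := ⟨e, hx⟩
  have : h.choose = e := eq_of_heq (Sigma.mk.inj (eq_of_mem_oCell h.choose_spec hx)).2
  rw [modify, dif_pos h, this]

lemma modify_of_forall_notMem {x : X} (hx : ∀ e : Cell X k, x ∉ oCell e) : modify u g x = g x :=
  dif_neg fun ⟨e, he⟩ => hx e he

lemma modify_of_mem_skel {x : X} (hx : x ∈ skel X k) : modify u g x = g x :=
  modify_of_forall_notMem fun _ he => notMem_skel_of_mem_oCell he hx

lemma modify_chi {e : Cell X k} (h : ∀ y ∈ sphere (0 : Fin k → ℝ) 1, u e y = g (chi e y))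
    {y : Fin k → ℝ} (hy : y ∈ closedBall (0 : Fin k → ℝ) 1) : modify u g (chi e y) = u e y := by
  rcases mem_ball_or_sphere hy with hy | hy
  · rw [modify_of_mem_oCell (chi_mem_oCell e hy), chiInv_chi e hy]
  · rw [modify_of_mem_skel (chi_mem_skel_of_sphere e hy), h y hy]

lemma modify_chi_of_lt {m : ℕ} (hm : m < k) {e : Cell X m} {y : Fin m → ℝ}
    (hy : y ∈ closedBall (0 : Fin m → ℝ) 1) : modify u g (chi e y) = g (chi e y) :=
  modify_of_mem_skel (skel_mono (by lia) (chi_mem_skel e hy))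

variable [TopologicalSpace E]

lemma continuousOn_modify (hg : ContinuousOn g (skel X k))
    (hu : ∀ e, ContinuousOn (u e) (closedBall 0 1))
    (h : ∀ e, ∀ y ∈ sphere (0 : Fin k → ℝ) 1, u e y = g (chi e y)) :
    ContinuousOn (modify u g) (skel X (k + 1)) := by
  refine continuousOn_skel fun m hm e => ?_
  rcases Nat.lt_succ_iff_lt_or_eq.1 hm with hm | rfl
  · refine ContinuousOn.congr ?_ fun y hy => modify_chi_of_lt hm hy
    exact hg.comp (continuousOn_chi e) fun y hy => skel_mono (by lia) (chi_mem_skel e hy)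
  · exact (hu e).congr fun y hy => modify_chi (h e) hy

/-- Construct a continuous map on a CW complex cell by cell, each cell being subject to a
condition `Good`. -/
theorem exists_continuous_of_cells [Nonempty E]
    (Good : ∀ k, Cell X k → ((Fin k → ℝ) → E) → Prop)
    (hcongr : ∀ k e u v, EqOn u v (closedBall 0 1) → Good k e u → Good k e v)
    (step : ∀ k (g : X → E), ContinuousOn g (skel X k) →
      (∀ m < k, ∀ e : Cell X m, Good m e (fun y => g (chi e y))) → ∀ e : Cell X k,
      ∃ u : (Fin k → ℝ) → E, ContinuousOn u (closedBall 0 1) ∧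
        (∀ y ∈ sphere (0 : Fin k → ℝ) 1, u y = g (chi e y)) ∧ Good k e u) :
    ∃ g : C(X, E), ∀ k (e : Cell X k), Good k e (fun y => g (chi e y)) := by
  -- Stage `k` is a total function of which only the values on `skel X k` matter. Later stages agree
  -- with it there, so the limit is defined pointwise.
  let P : ℕ → Type _ := fun k => {g : X → E // ContinuousOn g (skel X k) ∧
    ∀ m < k, ∀ e : Cell X m, Good m e (fun y => g (chi e y))}
  have hstep : ∀ k (g : P k), ∃ g' : P (k + 1), EqOn g'.1 g.1 (skel X k) := by
    rintro k ⟨g, hg, hg'⟩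
    choose u hu hus hgood using step k g hg hg'
    refine ⟨⟨modify u g, continuousOn_modify hg hu hus, fun m hm e => ?_⟩,
      fun x hx => modify_of_mem_skel hx⟩
    rcases Nat.lt_succ_iff_lt_or_eq.1 hm with hm | rfl
    · exact hcongr _ _ _ _ (fun y hy => (modify_chi_of_lt hm hy).symm) (hg' m hm e)
    · exact hcongr _ _ _ _ (fun y hy => (modify_chi (hus e) hy).symm) (hgood e)
  choose next hnext using hstep
  have h0 : skel X 0 = ∅ := by
    ext x; simp [mem_skel_iff]
  let G : ∀ k, P k := fun k => Nat.rec
    ⟨fun _ => Classical.arbitrary E, by rw [h0]; exact continuousOn_empty _,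
      fun m hm => absurd hm (by lia)⟩ next k
  have hG : ∀ k j, EqOn (G (k + j)).1 (G k).1 (skel X k) := by
    intro k j
    induction j with
    | zero => exact fun _ _ => rfl
    | succ j ih =>
      exact fun x hx => (hnext (k + j) (G (k + j)) (skel_mono (by lia) hx)).trans (ih hx)
  have hG' : ∀ {k m : ℕ} {x : X}, x ∈ skel X k → x ∈ skel X m → (G k).1 x = (G m).1 x := by
    intro k m x hk hm
    rcases le_total k m with h | h
    · obtain ⟨j, rfl⟩ := Nat.exists_eq_add_of_le h
      exact (hG k j hk).symm
    · obtain ⟨j, rfl⟩ := Nat.exists_eq_add_of_le h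
      exact hG m j hm
  let g : X → E := fun x => (G (iUnion_skel x).choose).1 x
  have hg : ∀ {k x}, x ∈ skel X k → g x = (G k).1 x := fun {k x} hx =>
    hG' (iUnion_skel x).choose_spec hx
  have hgc : ∀ m (e : Cell X m), EqOn (fun y => (G (m + 1)).1 (chi e y)) (fun y => g (chi e y))
      (closedBall 0 1) := fun m e y hy => (hg (chi_mem_skel e hy)).symm
  refine ⟨⟨g, continuous_of_cells fun m e => ?_⟩, fun k e => ?_⟩
  · refine ContinuousOn.congr ?_ (hgc m e).symm
    exact (G (m + 1)).2.1.comp (continuousOn_chi e) fun y hy => chi_mem_skel e hy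
  · exact hcongr _ _ _ _ (hgc k e) ((G (k + 1)).2.2 k (by lia) e)

end Modify

/-! ### Radial expansion of cells. -/

section Expand

variable {X : Type*} [TopologicalSpace X] [T2Space X] [Topology.CWComplex (Set.univ : Set X)]
  {k : ℕ}

/-- Radial expansion by the factor `max 1 l`, followed by the radial retraction onto the ball. -/
noncomputable def radial (l : ℝ) (y : Fin k → ℝ) : Fin k → ℝ :=
  (max 1 l / max 1 (max 1 l * ‖y‖)) • y

lemma continuous_radial : Continuous fun p : ℝ × (Fin k → ℝ) => radial p.1 p.2 := by
  unfold radial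
  have h1 : Continuous fun p : ℝ × (Fin k → ℝ) => max 1 p.1 := by fun_prop
  have h2 : Continuous fun p : ℝ × (Fin k → ℝ) => max 1 (max 1 p.1 * ‖p.2‖) := by fun_prop
  exact (h1.div h2 fun p => (lt_max_of_lt_left one_pos).ne').smul continuous_snd

lemma norm_radial (l : ℝ) (y : Fin k → ℝ) : ‖radial l y‖ = min 1 (max 1 l * ‖y‖) := by
  have h1 : (1 : ℝ) ≤ max 1 l := le_max_left _ _
  have h2 : (1 : ℝ) ≤ max 1 (max 1 l * ‖y‖) := le_max_left _ _
  rw [radial, norm_smul, Real.norm_of_nonneg (by positivity), div_mul_eq_mul_div]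
  rcases le_total 1 (max 1 l * ‖y‖) with h | h
  · rw [max_eq_right h, min_eq_left h, div_self (by linarith)]
  · rw [max_eq_left h, min_eq_right h, div_one]

lemma radial_mem (l : ℝ) (y : Fin k → ℝ) : radial l y ∈ closedBall (0 : Fin k → ℝ) 1 := by
  rw [mem_closedBall_zero_iff, norm_radial]; exact min_le_left _ _

lemma radial_of_norm_eq_one (l : ℝ) {y : Fin k → ℝ} (hy : ‖y‖ = 1) : radial l y = y := by
  have h1 : (1 : ℝ) ≤ max 1 l := le_max_left _ _
  rw [radial, hy, mul_one, max_eq_right h1, div_self (by linarith), one_smul]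

lemma radial_one {y : Fin k → ℝ} (hy : ‖y‖ ≤ 1) : radial 1 y = y := by
  rw [radial, max_self, one_mul, max_eq_left hy, div_one, one_smul]

variable (X k) in
/-- Expand the cells of dimension `k` radially by the factor `l`. -/
noncomputable def expand (l : ℝ) : X → X :=
  modify (k := k) (fun e y => chi e (radial l y)) id

variable (X k) in
/-- The norm of the coordinates of a point in a cell of dimension `k`, and `1` elsewhere. -/
noncomputable def radius : X → ℝ := modify (k := k) (fun _ y => ‖y‖) fun _ => 1

lemma expand_chi (l : ℝ) (e : Cell X k) {y : Fin k → ℝ} (hy : y ∈ closedBall (0 : Fin k → ℝ) 1) :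
    expand X k l (chi e y) = chi e (radial l y) :=
  modify_chi (fun y hy => by rw [radial_of_norm_eq_one l (by simpa using hy)]; rfl) hy

lemma expand_of_mem_skel (l : ℝ) {x : X} (hx : x ∈ skel X k) : expand X k l x = x :=
  modify_of_mem_skel hx

lemma radius_chi (e : Cell X k) {y : Fin k → ℝ} (hy : y ∈ closedBall (0 : Fin k → ℝ) 1) :
    radius X k (chi e y) = ‖y‖ :=
  modify_chi (fun y hy => by simpa using hy) hy

lemma radius_of_mem_skel {x : X} (hx : x ∈ skel X k) : radius X k x = 1 :=
  modify_of_mem_skel hx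

lemma continuousOn_radius : ContinuousOn (radius X k) (skel X (k + 1)) :=
  continuousOn_modify continuousOn_const (fun _ => continuous_norm.continuousOn)
    fun _ y hy => by simpa using hy

lemma continuousOn_expand :
    ContinuousOn (fun p : ℝ × X => expand X k p.1 p.2) (univ ×ˢ skel X (k + 1)) := by
  refine continuousOn_skel_prod fun m hm e => ?_
  rcases Nat.lt_succ_iff_lt_or_eq.1 hm with hm | rfl
  · exact ((continuousOn_chi e).comp continuousOn_snd fun p hp => hp.2).congr
      fun p hp => modify_chi_of_lt hm hp.2
  · refine ContinuousOn.congr ?_ fun p hp => expand_chi p.1 e hp.2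
    exact (continuousOn_chi e).comp continuous_radial.continuousOn fun p _ => radial_mem _ _

lemma expand_mem_skel (l : ℝ) {x : X} (hx : x ∈ skel X (k + 1)) :
    expand X k l x ∈ skel X (k + 1) := by
  rcases mem_skel_succ_iff.1 hx with h | ⟨e, y, hy, rfl⟩
  · rwa [expand_of_mem_skel l h]
  · change expand X k l (chi e y) ∈ _
    rw [expand_chi l e (ball_subset_closedBall hy)]
    exact chi_mem_skel e (radial_mem _ _)

lemma expand_one {x : X} (hx : x ∈ skel X (k + 1)) : expand X k 1 x = x := by
  rcases mem_skel_succ_iff.1 hx with h | ⟨e, y, hy, rfl⟩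
  · rw [expand_of_mem_skel 1 h]
  · change expand X k 1 (chi e y) = chi e y
    rw [expand_chi 1 e (ball_subset_closedBall hy),
      radial_one (by simpa using ball_subset_closedBall hy)]

/-- A factor at least the inverse of the radius pushes the point to the frontier of its cell. This
is how maps that avoid the centers are moved into the lower skeleton. -/
lemma expand_mem_skel_of_le {l : ℝ} {x : X} (hx : x ∈ skel X (k + 1))
    (h : 1 ≤ l * radius X k x) : expand X k l x ∈ skel X k := by
  rcases mem_skel_succ_iff.1 hx with h' | ⟨e, y, hy, rfl⟩
  · rwa [expand_of_mem_skel l h']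
  · have hy' := ball_subset_closedBall hy
    change 1 ≤ l * radius X k (chi e y) at h
    change expand X k l (chi e y) ∈ _
    rw [radius_chi e hy'] at h
    rw [expand_chi l e hy']
    apply chi_mem_skel_of_sphere
    rw [mem_sphere_zero_iff_norm, norm_radial, min_eq_left]
    exact h.trans (mul_le_mul_of_nonneg_right (le_max_right _ _) (norm_nonneg _))

lemma radius_nonneg (x : X) : 0 ≤ radius X k x := by
  by_cases h : ∃ e : Cell X k, x ∈ oCell e
  · obtain ⟨e, he⟩ := h
    rw [radius, modify_of_mem_oCell he]; exact norm_nonneg _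
  · push Not at h
    rw [radius, modify_of_forall_notMem h]; exact zero_le_one

/-- An open cell is relatively open in the skeleton of its dimension. -/
lemma exists_isOpen_oCell (e : Cell X k) : ∃ O : Set X, IsOpen O ∧ O ∩ skel X (k + 1) = oCell e := by
  classical
  -- This is the radius in the single cell `e`, equal to `1` elsewhere, so the open cell is the
  -- locus where it is less than `1`.
  let ρ : X → ℝ := modify (k := k) (fun e' y => if e' = e then ‖y‖ else 1) fun _ => 1
  have hρ : ContinuousOn ρ (skel X (k + 1)) := by
    refine continuousOn_modify continuousOn_const (fun e' => ?_) fun e' y hy => ?_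
    · split_ifs <;> fun_prop
    · split_ifs
      · simpa using hy
      · rfl
  obtain ⟨O, hO, hO'⟩ := (_root_.continuousOn_iff'.1 hρ) (Iio 1) isOpen_Iio
  refine ⟨O, hO, ?_⟩
  rw [← hO']
  ext x
  constructor
  · rintro ⟨h1, h2⟩
    rcases mem_skel_succ_iff.1 h2 with h | ⟨e', he'⟩
    · exact absurd h1 (by simp [ρ, modify_of_mem_skel h])
    · by_cases hee : e' = e
      · exact hee ▸ he'
      · exact absurd h1 (by simp [ρ, modify_of_mem_oCell he', hee])
  · intro hx
    refine ⟨?_, mem_skel_succ_iff.2 (.inr ⟨e, hx⟩)⟩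
    have := chiInv_mem e hx
    simpa [ρ, modify_of_mem_oCell hx] using this

end Expand

/-! ### Cubes representing elements of a subgroup, and subdivision of boxes. -/

section InSub

open Topology.Homotopy

variable {n : ℕ} [Nonempty (Fin n)] {W : Type*} [TopologicalSpace W] {w : W}

/-- The map `g` is a generalized loop whose class belongs to the subgroup `Γ`. -/
def InSub (Γ : Subgroup (HomotopyGroup (Fin n) W w)) (g : (Fin n → I) → W) : Prop :=
  ∃ p : Ω^ (Fin n) W w, (∀ s, p s = g s) ∧ piClass p ∈ Γ

variable {Γ : Subgroup (HomotopyGroup (Fin n) W w)} {g g' : (Fin n → I) → W}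

lemma InSub.congr (h : InSub Γ g) (hg : ∀ s, g s = g' s) : InSub Γ g' := by
  obtain ⟨p, hp, h⟩ := h
  exact ⟨p, fun s => (hp s).trans (hg s), h⟩

lemma InSub.homotopy (h : InSub Γ g) {H : I × (Fin n → I) → W} (hH : Continuous H)
    (h0 : ∀ s, H (0, s) = g s) (h1 : ∀ s, H (1, s) = g' s)
    (hb : ∀ t, ∀ s ∈ Cube.boundary (Fin n), H (t, s) = w) : InSub Γ g' := by
  obtain ⟨p, hp, h⟩ := h
  have hc : Continuous g' := by
    have : g' = fun s => H (1, s) := funext fun s => (h1 s).symm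
    rw [this]; fun_prop
  let p' : Ω^ (Fin n) W w := ⟨⟨g', hc⟩, fun s hs => (h1 s).symm.trans (hb 1 s hs)⟩
  refine ⟨p', fun _ => rfl, ?_⟩
  have : piClass p = piClass p' := piClass_eq_iff.2
    ⟨⟨⟨⟨H, hH⟩, fun s => (h0 s).trans (hp s).symm, h1⟩, fun t s hs =>
      (hb t s hs).trans (p.2 s hs).symm⟩⟩
  rwa [← this]

lemma inSub_const (hg : ∀ s, g s = w) : InSub Γ g :=
  ⟨GenLoop.const, fun s => (hg s).symm, by rw [piClass_const]; exact Γ.one_mem⟩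

lemma InSub.reflect (i : Fin n) (h : InSub Γ g) :
    InSub Γ fun s => g fun j => if j = i then unitInterval.symm (s j) else s j := by
  obtain ⟨p, hp, h⟩ := h
  refine ⟨GenLoop.symmAt i p, fun s => ?_, by rw [← piClass_inv]; exact Γ.inv_mem h⟩
  refine Eq.trans ?_ (hp _)
  change p _ = p _
  congr 1
  funext j
  split_ifs with hj
  · rw [hj]
  · rfl

/-- The affine map from the unit cube onto the box with the given corners. -/
def param (l u : Fin n → ℝ) (s : Fin n → I) : Fin n → ℝ := fun i => l i + s i * (u i - l i)

@[fun_prop]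
lemma continuous_param (l u : Fin n → ℝ) : Continuous (param l u) := by
  unfold param; fun_prop

/-- The map on the whole box is the concatenation in direction `i` of the maps on its halves, so its
class is their product. -/
lemma InSub.of_halves {b : (Fin n → ℝ) → W} {l u : Fin n → ℝ} (i : Fin n) {m : ℝ}
    (hm : m = (l i + u i) / 2)
    (h₁ : InSub Γ fun s => b (param l (Function.update u i m) s))
    (h₂ : InSub Γ fun s => b (param (Function.update l i m) u s)) :
    InSub Γ fun s => b (param l u s) := by
  obtain ⟨p, hp, hpΓ⟩ := h₁
  obtain ⟨q, hq, hqΓ⟩ := h₂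
  refine ⟨GenLoop.transAt i p q, fun s => ?_, by rw [← piClass_mul]; exact Γ.mul_mem hqΓ hpΓ⟩
  have h0 := (s i).2.1
  have h1 := (s i).2.2
  change (if (s i : ℝ) ≤ 1 / 2 then _ else _) = _
  split_ifs with hs
  · refine (hp _).trans (congrArg b ?_)
    funext j
    by_cases hj : j = i
    · subst hj
      simp only [param, Function.update_self]
      rw [projIcc_of_mem zero_le_one ⟨by linarith, by linarith⟩, hm]
      ring
    · simp [param, Function.update_of_ne hj]
  · refine (hq _).trans (congrArg b ?_)
    funext j
    by_cases hj : j = i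
    · subst hj
      simp only [param, Function.update_self]
      rw [projIcc_of_mem zero_le_one ⟨by linarith, by linarith⟩, hm]
      ring
    · simp [param, Function.update_of_ne hj]

-- The halves are merged one direction at a time. In the induction `T` is the set of directions
-- already merged, and the box is still cut in the directions of the complement.
open Classical in
lemma InSub.of_splitCenterBox {b : (Fin n → ℝ) → W} (J : BoxIntegral.Box (Fin n))
    (h : ∀ S, InSub Γ fun s => b (param (J.splitCenterBox S).lower (J.splitCenterBox S).upper s)) :
    InSub Γ fun s => b (param J.lower J.upper s) := by
  let m : Fin n → ℝ := fun i => (J.lower i + J.upper i) / 2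
  let lo : Finset (Fin n) → Set (Fin n) → Fin n → ℝ := fun T S i =>
    if i ∈ T ∧ i ∈ S then m i else J.lower i
  let up : Finset (Fin n) → Set (Fin n) → Fin n → ℝ := fun T S i =>
    if i ∈ T ∧ i ∉ S then m i else J.upper i
  have key : ∀ T : Finset (Fin n), ∀ S, InSub Γ fun s => b (param (lo Tᶜ S) (up Tᶜ S) s) := by
    intro T
    induction T using Finset.induction_on with
    | empty =>
      intro S
      convert h S using 4
      · funext i; simp [lo, BoxIntegral.Box.splitCenterBox, Set.piecewise, m]
      · funext i; simp only [up, BoxIntegral.Box.splitCenterBox, Set.piecewise, m]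
        by_cases hi : i ∈ S <;> simp [hi]
    | insert i T hi ih =>
      intro S
      have e1 : lo (insert i T)ᶜ S = lo Tᶜ (S \ {i}) := by
        funext j; simp only [lo]; by_cases hj : j = i <;> simp [hj]
      have e2 : Function.update (up (insert i T)ᶜ S) i (m i) = up Tᶜ (S \ {i}) := by
        funext j; simp only [up]; by_cases hj : j = i
        · subst hj; simp [hi]
        · simp [hj]
      have e3 : up (insert i T)ᶜ S = up Tᶜ (insert i S) := by
        funext j; simp only [up]; by_cases hj : j = i <;> simp [hj]
      have e4 : Function.update (lo (insert i T)ᶜ S) i (m i) = lo Tᶜ (insert i S) := by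
        funext j; simp only [lo]; by_cases hj : j = i
        · subst hj; simp [hi]
        · simp [hj]
      refine InSub.of_halves i (m := m i) ?_ ?_ ?_
      · simp [lo, up, m]
      · rw [e1, e2]; exact ih _
      · rw [e3, e4]; exact ih _
  convert key Finset.univ ∅ using 4
  · funext i; simp [lo]
  · funext i; simp [up]

end InSub

/-! ### Local degree and linear maps. -/

section Degree

variable {n : ℕ} [Nonempty (Fin n)] {W : Type*} [TopologicalSpace W] {w : W}

/-- The map `q` from the cube, followed by a large dilatation and by `H`, is a generalized loop
whose class belongs to `Γ`. -/
def Deg (Γ : Subgroup (HomotopyGroup (Fin n) W w)) (H : (Fin n → ℝ) → W)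
    (q : (Fin n → I) → Fin n → ℝ) : Prop :=
  ∃ L : ℝ, ∀ l ≥ L, InSub Γ fun s => H (l • q s)

variable {Γ : Subgroup (HomotopyGroup (Fin n) W w)} {H : (Fin n → ℝ) → W}

lemma Deg.congr {q q' : (Fin n → I) → Fin n → ℝ} (h : Deg Γ H q) (hq : ∀ s, q s = q' s) :
    Deg Γ H q' := by
  rwa [← show q = q' from funext hq]

lemma isCompact_boundary : IsCompact (Cube.boundary (Fin n)) := by
  have : Cube.boundary (Fin n) = {s | ‖cubeToBall s‖ = 1} := by
    ext s; exact mem_boundary_iff s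
  rw [this]
  exact (isClosed_eq (by fun_prop) continuous_const).isCompact

/-- By compactness `Q` is bounded away from zero on the boundary. A large dilatation therefore moves
the boundary out of the open unit ball, where `H` is constant, and the homotopy becomes one of
generalized loops. -/
lemma Deg.homotopy (hH : Continuous H) (hHw : ∀ x, 1 ≤ ‖x‖ → H x = w)
    {Q : I × (Fin n → I) → Fin n → ℝ} (hQ : Continuous Q)
    (hQ0 : ∀ t, ∀ s ∈ Cube.boundary (Fin n), Q (t, s) ≠ 0) (h : Deg Γ H fun s => Q (0, s)) :
    Deg Γ H fun s => Q (1, s) := by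
  obtain ⟨L, hL⟩ := h
  obtain ⟨c, hc, hc'⟩ := ((isCompact_univ (X := I)).prod
    (isCompact_boundary (n := n))).exists_forall_le' (f := fun p => ‖Q p‖) (a := 0)
    (by fun_prop) (fun p hp => norm_pos_iff.2 (hQ0 p.1 p.2 hp.2))
  refine ⟨max L c⁻¹, fun l hl => ?_⟩
  have hl1 : c⁻¹ ≤ l := (le_max_right _ _).trans hl
  have hl0 : 0 < l := (inv_pos.2 hc).trans_le hl1
  refine (hL l ((le_max_left _ _).trans hl)).homotopy (H := fun p => H (l • Q p)) (by fun_prop)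
    (fun _ => rfl) (fun _ => rfl) fun t s hs => hHw _ ?_
  rw [norm_smul, Real.norm_of_nonneg hl0.le]
  calc (1 : ℝ) = c⁻¹ * c := (inv_mul_cancel₀ hc.ne').symm
    _ ≤ l * ‖Q (t, s)‖ := mul_le_mul hl1 (hc' _ ⟨mem_univ _, hs⟩) hc.le hl0.le

lemma deg_cubeToBall (hH : Continuous H) (hHw : ∀ x, 1 ≤ ‖x‖ → H x = w)
    (h : InSub Γ fun s => H (cubeToBall s)) : Deg Γ H cubeToBall := by
  refine ⟨1, fun l hl => ?_⟩
  refine h.homotopy (H := fun p => H ((1 + (p.1 : ℝ) * (l - 1)) • cubeToBall p.2)) (by fun_prop)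
    (fun s => by simp) (fun s => by simp) fun t s hs => hHw _ ?_
  rw [norm_smul, (mem_boundary_iff s).1 hs, mul_one]
  have h0 := t.2.1
  refine le_trans ?_ (le_abs_self _)
  nlinarith

lemma Deg.reflect {q : (Fin n → I) → Fin n → ℝ} (i : Fin n) (h : Deg Γ H q) :
    Deg Γ H fun s => q fun j => if j = i then unitInterval.symm (s j) else s j := by
  obtain ⟨L, hL⟩ := h
  exact ⟨L, fun l hl => (hL l hl).reflect i⟩

/-- Signs are flipped one at a time; each flip inverts the class, and a subgroup is closed under
inverses. -/
lemma deg_diagonal (h : Deg Γ H cubeToBall) (ε : Fin n → ℝ) (hε : ∀ i, ε i = 1 ∨ ε i = -1) :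
    Deg Γ H fun s => (Matrix.diagonal ε).mulVec (cubeToBall s) := by
  classical
  have key : ∀ T : Finset (Fin n), Deg Γ H fun s i => if i ∈ T then -cubeToBall s i
      else cubeToBall s i := by
    intro T
    induction T using Finset.induction_on with
    | empty => simpa using h
    | insert i T hi ih =>
      refine (ih.reflect i).congr fun s => ?_
      funext j
      by_cases hj : j = i
      · subst hj
        simp [hi, cubeToBall]
        ring
      · simp [hj, cubeToBall]
  refine (key (Finset.univ.filter fun i => ε i = -1)).congr fun s => ?_
  funext i
  rw [Matrix.mulVec_diagonal]
  rcases hε i with h | h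
  · have hn : i ∉ Finset.univ.filter fun i => ε i = -1 := fun hc => by
      have := (Finset.mem_filter.1 hc).2
      rw [h] at this
      norm_num at this
    rw [if_neg hn, h, one_mul]
  · simp [h]

/-- The invertible matrix `A` is connected to a diagonal matrix with entries `±1`. -/
lemma joinedIn_diagonal (A : Matrix (Fin n) (Fin n) ℝ) (hA : A.det ≠ 0) :
    ∃ ε : Fin n → ℝ, (∀ i, ε i = 1 ∨ ε i = -1) ∧
      JoinedIn {M : Matrix (Fin n) (Fin n) ℝ | M.det ≠ 0} A (Matrix.diagonal ε) := by
  -- Gaussian elimination writes the matrix as a product of transvections and a diagonal matrix.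
  -- Transvections shrink to the identity, and diagonal entries move linearly to their signs.
  refine Matrix.diagonal_transvection_induction_of_det_ne_zero
    (fun A => ∃ ε : Fin n → ℝ, (∀ i, ε i = 1 ∨ ε i = -1) ∧
      JoinedIn {M : Matrix (Fin n) (Fin n) ℝ | M.det ≠ 0} A (Matrix.diagonal ε)) A hA ?_ ?_ ?_
  · intro D hD
    rw [Matrix.det_diagonal, Finset.prod_ne_zero_iff] at hD
    have hsgn : ∀ i, (SignType.sign (D i) : ℝ) = 1 ∨ (SignType.sign (D i) : ℝ) = -1 := by
      intro i
      rcases lt_or_gt_of_ne (hD i (Finset.mem_univ i)) with h | h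
      · right; simp [h]
      · left; simp [h]
    refine ⟨fun i => SignType.sign (D i), hsgn, ?_⟩
    refine ⟨⟨⟨fun t => Matrix.diagonal fun i => (1 - (t : ℝ)) * D i + t * SignType.sign (D i),
      Continuous.matrix_diagonal (by fun_prop)⟩, by simp, by simp⟩, fun t => ?_⟩
    change Matrix.det (Matrix.diagonal _) ≠ 0
    rw [Matrix.det_diagonal, Finset.prod_ne_zero_iff]
    intro i _
    have h0 := t.2.1
    have h1 := t.2.2
    rcases lt_or_gt_of_ne (hD i (Finset.mem_univ i)) with h | h
    · rw [sign_neg h]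
      simp only [SignType.coe_neg_one]
      refine (?_ : (1 - (t : ℝ)) * D i + t * -1 < 0).ne
      rcases eq_or_lt_of_le h0 with h2 | h2
      · rw [← h2]; linarith
      · nlinarith
    · rw [sign_pos h]
      simp only [SignType.coe_one]
      refine (?_ : 0 < (1 - (t : ℝ)) * D i + t * 1).ne'
      rcases eq_or_lt_of_le h0 with h2 | h2
      · rw [← h2]; linarith
      · nlinarith
  · intro T
    refine ⟨fun _ => 1, fun _ => .inl rfl, ?_⟩
    rw [Matrix.diagonal_one]
    refine ⟨⟨⟨fun t => Matrix.transvection T.i T.j ((1 - (t : ℝ)) * T.c), ?_⟩, ?_, ?_⟩, fun t => ?_⟩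
    · unfold Matrix.transvection
      refine continuous_const.add ?_
      refine continuous_matrix fun i j => ?_
      simp only [Matrix.single_apply]
      split_ifs <;> fun_prop
    · simp [Matrix.TransvectionStruct.toMatrix]
    · simp
    · change Matrix.det (Matrix.transvection T.i T.j ((1 - (t : ℝ)) * T.c)) ≠ 0
      rw [Matrix.det_transvection_of_ne _ _ T.hij]
      exact one_ne_zero
  · rintro A B - - ⟨ε, hε, γ, hγ⟩ ⟨ε', hε', γ', hγ'⟩
    refine ⟨fun i => ε i * ε' i, fun i => ?_, ⟨⟨⟨fun t => γ t * γ' t, by fun_prop⟩, by simp,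
      by simp⟩, fun t => ?_⟩⟩
    · rcases hε i with h | h <;> rcases hε' i with h' | h' <;> simp [h, h']
    · change Matrix.det (γ t * γ' t) ≠ 0
      rw [Matrix.det_mul]
      exact mul_ne_zero (hγ t) (hγ' t)

/-- Along the path of invertible matrices no boundary vector is sent to zero, so the diagonal case
carries over by `Deg.homotopy`. -/
lemma deg_linear (hH : Continuous H) (hHw : ∀ x, 1 ≤ ‖x‖ → H x = w)
    (h : Deg Γ H cubeToBall) (A : Matrix (Fin n) (Fin n) ℝ) (hA : A.det ≠ 0) :
    Deg Γ H fun s => A.mulVec (cubeToBall s) := by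
  obtain ⟨ε, hε, γ, hγ⟩ := joinedIn_diagonal A hA
  have hQ : Continuous fun p : I × (Fin n → I) => (γ.symm p.1).mulVec (cubeToBall p.2) :=
    (γ.symm.continuous.comp continuous_fst).matrix_mulVec (by fun_prop)
  have := Deg.homotopy hH hHw hQ (fun t s hs h0 => ?_) (by simpa using deg_diagonal h ε hε)
  · simpa using this
  · have hne : cubeToBall s ≠ 0 := fun h1 => by
      have := (mem_boundary_iff s).1 hs
      rw [h1, norm_zero] at this
      exact zero_ne_one this
    exact hγ (unitInterval.symm t) (Matrix.exists_mulVec_eq_zero_iff.1 ⟨_, hne, h0⟩)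

/-- Near a point where `q` vanishes and has an invertible derivative, small boxes around the point
have their degree in the subgroup. -/
lemma deg_local (hH : Continuous H) (hHw : ∀ x, 1 ≤ ‖x‖ → H x = w) (h : Deg Γ H cubeToBall)
    {q : (Fin n → ℝ) → Fin n → ℝ} {q' : (Fin n → ℝ) →L[ℝ] Fin n → ℝ} {z : Fin n → ℝ}
    (hq : HasFDerivAt q q' z) (hz : q z = 0) (hdet : q'.det ≠ 0) :
    ∃ r > 0, ∀ l u : Fin n → ℝ, (∀ i, l i < z i ∧ z i < u i) →
      (∀ s, param l u s ∈ ball z r) → ContinuousOn q (ball z r) →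
      Deg Γ H fun s => q (param l u s) := by
  have hker : (q' : (Fin n → ℝ) →ₗ[ℝ] Fin n → ℝ).ker = ⊥ := by
    by_contra hc
    exact hdet (LinearMap.det_eq_zero_iff_ker_ne_bot.2 hc)
  obtain ⟨K, hK, hanti⟩ := LinearMap.exists_antilipschitzWith _ hker
  have hlow : ∀ x, ‖x‖ ≤ K * ‖q' x‖ := by
    intro x
    simpa using hanti.le_mul_dist x 0
  -- With this constant the Taylor remainder is at most half the norm of the linear part, so the two
  -- cannot cancel.
  have hlo := hq.isLittleO.def (c := (2 * (K : ℝ))⁻¹) (by positivity)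
  obtain ⟨r, hr, hball⟩ := Metric.eventually_nhds_iff_ball.1 hlo
  refine ⟨r, hr, fun l u hlu hs hcont => ?_⟩
  let A : Matrix (Fin n) (Fin n) ℝ := LinearMap.toMatrix' (q' : (Fin n → ℝ) →ₗ[ℝ] Fin n → ℝ)
  have hA : ∀ x, A.mulVec x = q' x := fun x => LinearMap.toMatrix'_mulVec _ x
  have hAdet : A.det ≠ 0 := by
    rw [LinearMap.det_toMatrix']; exact hdet
  have h1 : Deg Γ H fun s => q' (cubeToBall s) :=
    (deg_linear hH hHw h A hAdet).congr fun s => hA _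
  have hne : ∀ x, x ≠ 0 → q' x ≠ 0 := fun x hx h0 => hx (by
    have := hlow x
    rw [h0, norm_zero, mul_zero] at this
    exact norm_le_zero_iff.1 this)
  have hpz : ∀ s ∈ Cube.boundary (Fin n), param l u s - z ≠ 0 := by
    rintro s ⟨i, hi⟩ h0
    have := congrFun h0 i
    have hi' := hlu i
    simp only [param, Pi.sub_apply, Pi.zero_apply] at this
    rcases hi with hi | hi <;> rw [hi] at this <;> simp at this <;> linarith
  -- On a face of the cube the corresponding coordinate has the same strict sign for both end maps,
  -- because `z` is interior to the box; the segment between them thus avoids zero.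
  have h2 : Deg Γ H fun s => q' (param l u s - z) := by
    have := Deg.homotopy hH hHw (Γ := Γ) (Q := fun p : I × (Fin n → I) =>
      q' ((1 - (p.1 : ℝ)) • cubeToBall p.2 + (p.1 : ℝ) • (param l u p.2 - z)))
      (by fun_prop) (fun t s hs => hne _ ?_) (by simpa using h1)
    · simpa using this
    · obtain ⟨i, hi⟩ := hs
      intro h0
      have := congrFun h0 i
      have hi' := hlu i
      have ht0 := t.2.1
      have ht1 := t.2.2
      simp only [param, Pi.sub_apply, Pi.zero_apply, Pi.add_apply, Pi.smul_apply, smul_eq_mul,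
        cubeToBall] at this
      rcases hi with hi | hi
      · rw [hi] at this; simp at this
        rcases eq_or_lt_of_le ht0 with h3 | h3
        · rw [← h3] at this; norm_num at this
        · nlinarith
      · rw [hi] at this; simp at this
        rcases eq_or_lt_of_le ht0 with h3 | h3
        · rw [← h3] at this; norm_num at this
        · nlinarith
  have hqc : Continuous fun s => q (param l u s) := hcont.comp_continuous (by fun_prop) hs
  have := Deg.homotopy hH hHw (Γ := Γ) (Q := fun p : I × (Fin n → I) =>
      q' (param l u p.2 - z) + (p.1 : ℝ) • (q (param l u p.2) - q' (param l u p.2 - z)))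
      (by
        have h7 : Continuous fun p : I × (Fin n → I) => q (param l u p.2) :=
          hqc.comp continuous_snd
        have h8 : Continuous fun p : I × (Fin n → I) => q' (param l u p.2 - z) := by fun_prop
        have h9 : Continuous fun p : I × (Fin n → I) => (p.1 : ℝ) := by fun_prop
        exact h8.add (h9.smul (h7.sub h8))) (fun t s hs' => ?_) (by simpa using h2)
  · simpa using this
  · intro h0
    have h3 := hball _ (hs s)
    rw [hz, sub_zero] at h3
    have h4 : ‖q' (param l u s - z)‖ ≤ ‖q (param l u s) - q' (param l u s - z)‖ := by
      have h7 := congrArg norm (eq_neg_of_add_eq_zero_left h0)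
      rw [norm_neg, norm_smul, Real.norm_of_nonneg t.2.1] at h7
      rw [h7]
      exact mul_le_of_le_one_left (norm_nonneg _) t.2.2
    have h5 := hlow (param l u s - z)
    have hp : 0 < ‖param l u s - z‖ := norm_pos_iff.2 (hpz s hs')
    have h6 : K * ‖q' (param l u s - z)‖ ≤ ‖param l u s - z‖ / 2 := by
      calc (K : ℝ) * ‖q' (param l u s - z)‖
          ≤ K * ((2 * (K : ℝ))⁻¹ * ‖param l u s - z‖) := by gcongr; exact h4.trans h3
        _ = ‖param l u s - z‖ / 2 := by
          have : (K : ℝ) ≠ 0 := by positivity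
          field_simp
    linarith

end Degree

/-! ### Prescribing a map near the preimages of the cell centers. -/

section Perturb

variable {X : Type*} [TopologicalSpace X] [T2Space X] [Topology.CWComplex (Set.univ : Set X)]
  {k : ℕ} {V : Type*} [NormedAddCommGroup V]

/-- A cut-off function, equal to `1` on the ball of radius `1 / 4` and to `0` outside the ball of
radius `1 / 2`. -/
noncomputable def cutoff (y : Fin k → ℝ) : ℝ := max 0 (min 1 (2 - 4 * ‖y‖))

lemma cutoff_of_le {y : Fin k → ℝ} (h : ‖y‖ ≤ 1 / 4) : cutoff y = 1 := by
  rw [cutoff, min_eq_left (by linarith), max_eq_right zero_le_one]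

lemma cutoff_of_ge {y : Fin k → ℝ} (h : 1 / 2 ≤ ‖y‖) : cutoff y = 0 := by
  rw [cutoff, max_eq_left]
  exact (min_le_right _ _).trans (by linarith)

lemma cutoff_mem (y : Fin k → ℝ) : cutoff y ∈ Icc (0 : ℝ) 1 :=
  ⟨le_max_left _ _, max_le zero_le_one (min_le_left _ _)⟩

@[fun_prop]
lemma continuous_cutoff : Continuous (cutoff (k := k)) := by
  unfold cutoff; fun_prop

/-- A map into a skeleton can be deformed so that it is given, near the preimages of the centers of
the top cells, by prescribed approximations of its coordinates. -/
theorem exists_perturbation (a : C(V, X)) (ha : ∀ s, a s ∈ skel X (k + 1))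
    (P : Cell X k → C(V, Fin k → ℝ))
    (hP : ∀ e, ∀ y : Fin k → ℝ, ‖y‖ ≤ 1 / 2 → ∀ s, a s = chi e y → ‖P e s - y‖ < 1 / 4) :
    ∃ A : C(I × V, X), (∀ s, A (0, s) = a s) ∧ (∀ p, A p ∈ skel X (k + 1)) ∧
      (∀ t s, a s ∈ skel X k → A (t, s) = a s) ∧
      ∀ s e, A (1, s) = chi e 0 → P e s = 0 ∧
        ∃ r > 0, ∀ v ∈ ball s r, ‖P e v‖ < 1 ∧ A (1, v) = chi e (P e v) := by
  -- At time 1 the new coordinate is `P e` where the old one has norm at most `1 / 4`, and it is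
  -- unchanged where that norm is at least `1 / 2`.
  let Y : Cell X k → I × V → (Fin k → ℝ) → (Fin k → ℝ) := fun e p y =>
    y + ((p.1 : ℝ) * cutoff y) • (P e p.2 - y)
  let A : I × V → X := fun p => modify (k := k) (fun e y => chi e (Y e p y)) id (a p.2)
  have hAskel : ∀ p, a p.2 ∈ skel X k → A p = a p.2 := fun p hp => modify_of_mem_skel hp
  have hAcell : ∀ p e, a p.2 ∈ oCell e → A p = chi e (Y e p (chiInv e (a p.2))) :=
    fun p e hp => modify_of_mem_oCell hp
  have hYge : ∀ e p y, 1 / 2 ≤ ‖y‖ → Y e p y = y := fun e p y hy => by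
    simp [Y, cutoff_of_ge hy]
  have hPy : ∀ e s, a s ∈ oCell e → ‖chiInv e (a s)‖ ≤ 1 / 2 →
      ‖P e s - chiInv e (a s)‖ < 1 / 4 := fun e s hs hy =>
    hP e _ hy s (chi_chiInv e hs).symm
  have hYball : ∀ p e, a p.2 ∈ oCell e → Y e p (chiInv e (a p.2)) ∈ ball (0 : Fin k → ℝ) 1 := by
    intro p e hp
    rcases le_total (1 / 2) ‖chiInv e (a p.2)‖ with h | h
    · rw [hYge _ _ _ h]; exact chiInv_mem e hp
    · rw [mem_ball_zero_iff]
      have hc := cutoff_mem (chiInv e (a p.2))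
      have h1 : ‖((p.1 : ℝ) * cutoff (chiInv e (a p.2))) • (P e p.2 - chiInv e (a p.2))‖ ≤ 1 / 4 := by
        rw [norm_smul, Real.norm_of_nonneg (mul_nonneg p.1.2.1 hc.1)]
        exact (mul_le_of_le_one_left (norm_nonneg _) (mul_le_one₀ p.1.2.2 hc.1 hc.2)).trans
          (hPy e _ hp h).le
      calc _ ≤ ‖chiInv e (a p.2)‖ + _ := norm_add_le _ _
        _ < 1 := by linarith
  have hrad : Continuous fun s => radius X k (a s) :=
    continuousOn_radius.comp_continuous a.continuous ha
  have hopen : ∀ e : Cell X k, IsOpen {s | a s ∈ oCell e} := by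
    intro e
    obtain ⟨O, hO, hOe⟩ := exists_isOpen_oCell e
    have : {s | a s ∈ oCell e} = a ⁻¹' O := by
      ext s
      rw [mem_ofPred_eq, ← hOe]
      exact ⟨fun h => h.1, fun h => ⟨h, ha s⟩⟩
    rw [this]
    exact hO.preimage a.continuous
  have hinv : ∀ e : Cell X k, ContinuousOn (fun s => chiInv e (a s)) {s | a s ∈ oCell e} := fun e =>
    (continuousOn_chiInv e).comp a.continuous.continuousOn fun s hs => hs
  have hA : Continuous A := by
    rw [continuous_iff_continuousAt]
    rintro ⟨t₀, s₀⟩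
    rcases mem_skel_succ_iff.1 (ha s₀) with h | ⟨e, he⟩
    -- Near the lower skeleton the radius exceeds `1 / 2`, where nothing moves.
    · have hU : IsOpen {p : I × V | 1 / 2 < radius X k (a p.2)} :=
        isOpen_lt continuous_const (hrad.comp continuous_snd)
      have hmem : (t₀, s₀) ∈ {p : I × V | 1 / 2 < radius X k (a p.2)} := by
        simp only [mem_ofPred_eq, radius_of_mem_skel h]; norm_num
      refine ContinuousAt.congr (f := fun p : I × V => a p.2) (by fun_prop) ?_
      filter_upwards [hU.mem_nhds hmem] with p hp
      rcases mem_skel_succ_iff.1 (ha p.2) with h | ⟨e, he⟩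
      · exact (hAskel p h).symm
      · rw [hAcell p e he, hYge, chi_chiInv e he]
        rw [radius, modify_of_mem_oCell he] at hp
        exact hp.le
    · have hU : IsOpen {p : I × V | a p.2 ∈ oCell e} := (hopen e).preimage continuous_snd
      refine ContinuousOn.continuousAt (s := {p : I × V | a p.2 ∈ oCell e}) ?_ (hU.mem_nhds he)
      refine ContinuousOn.congr ?_ fun p hp => hAcell p e hp
      refine (continuousOn_chi e).comp (t := closedBall 0 1) ?_
        fun p hp => ball_subset_closedBall (hYball p e hp)
      have h1 : ContinuousOn (fun p : I × V => chiInv e (a p.2)) {p : I × V | a p.2 ∈ oCell e} :=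
        (hinv e).comp continuousOn_snd fun p hp => hp
      have h2 : ContinuousOn (fun p : I × V => cutoff (chiInv e (a p.2)))
          {p : I × V | a p.2 ∈ oCell e} := continuous_cutoff.comp_continuousOn h1
      simp only [Y]
      fun_prop
  refine ⟨⟨A, hA⟩, fun s => ?_, fun p => ?_, fun t s h => hAskel (t, s) h, fun s e hs => ?_⟩
  · rcases mem_skel_succ_iff.1 (ha s) with h | ⟨e, he⟩
    · exact hAskel (0, s) h
    · refine (hAcell (0, s) e he).trans ?_
      simp only [Y, Icc.coe_zero, zero_mul, zero_smul, add_zero]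
      exact chi_chiInv e he
  · change A p ∈ _
    rcases mem_skel_succ_iff.1 (ha p.2) with h | ⟨e, he⟩
    · rw [hAskel p h]; exact ha _
    · rw [hAcell p e he]
      exact chi_mem_skel e (ball_subset_closedBall (hYball p e he))
  · change A (1, s) = _ at hs
    have h0 : chi e 0 ∈ oCell e := chi_mem_oCell e (by simp)
    have hse : a s ∈ oCell e := by
      rcases mem_skel_succ_iff.1 (ha s) with h | ⟨e', he'⟩
      · exact absurd (hs ▸ hAskel (1, s) h ▸ h : chi e 0 ∈ skel X k) (notMem_skel_of_mem_oCell h0)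
      · have h1 : A (1, s) ∈ oCell e' := by
          rw [hAcell (1, s) e' he']; exact chi_mem_oCell e' (hYball (1, s) e' he')
        rw [hs] at h1
        have := eq_of_heq (Sigma.mk.inj (eq_of_mem_oCell h1 h0)).2
        exact this ▸ he'
    have hY0 : Y e (1, s) (chiInv e (a s)) = 0 := by
      rw [hAcell (1, s) e hse] at hs
      have := congrArg (chiInv e) hs
      rwa [chiInv_chi e (hYball (1, s) e hse), chiInv_chi e (by simp)] at this
    -- The displacement is less than `1 / 4`, so only points closer than that to the center can
    -- reach it; there the new map is exactly `P e`.
    have hlt : ‖chiInv e (a s)‖ < 1 / 4 := by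
      rcases le_total (1 / 2) ‖chiInv e (a s)‖ with h | h
      · rw [hYge _ _ _ h] at hY0
        rw [hY0, norm_zero]; norm_num
      · have hc := cutoff_mem (chiInv e (a s))
        have h1 := congrArg norm (eq_neg_of_add_eq_zero_left hY0)
        rw [norm_neg, norm_smul, Icc.coe_one, one_mul, Real.norm_of_nonneg hc.1] at h1
        rw [h1]
        exact (mul_le_of_le_one_left (norm_nonneg _) hc.2).trans_lt (hPy e s hse h)
    have hY1 : ∀ v, ‖chiInv e (a v)‖ < 1 / 4 → Y e (1, v) (chiInv e (a v)) = P e v := by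
      intro v hv
      simp [Y, cutoff_of_le hv.le]
    refine ⟨by rw [← hY1 s hlt, hY0], ?_⟩
    have hnhds : {v | a v ∈ oCell e ∧ ‖chiInv e (a v)‖ < 1 / 4} ∈ 𝓝 s := by
      have h1 := (hopen e).mem_nhds hse
      have h2 : ContinuousAt (fun v => ‖chiInv e (a v)‖) s := ((hinv e).continuousAt h1).norm
      filter_upwards [h1, h2.eventually_lt_const hlt] with v hv hv'
      exact ⟨hv, hv'⟩
    obtain ⟨r, hr, hsub⟩ := Metric.mem_nhds_iff.1 hnhds
    refine ⟨r, hr, fun v hv => ?_⟩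
    obtain ⟨h1, h2⟩ := hsub hv
    refine ⟨?_, ?_⟩
    · rw [← hY1 v h2]; simpa using hYball (1, v) e h1
    · rw [← hY1 v h2]; exact hAcell (1, v) e h1

end Perturb

/-! ### Smooth approximation and regular values. -/

section Transverse

variable {X : Type*} [TopologicalSpace X] [T2Space X] [Topology.CWComplex (Set.univ : Set X)]
  {k n : ℕ}

/-- The coordinates of a map in the inner half of a cell are approximated by smooth maps. -/
lemma exists_smooth_coordinates (a : C(Fin n → ℝ, X)) (e : Cell X k) :
    ∃ g : (Fin n → ℝ) → Fin k → ℝ, ContDiff ℝ 1 g ∧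
      ∀ y : Fin k → ℝ, ‖y‖ ≤ 1 / 2 → ∀ s, a s = chi e y → ‖g s - y‖ < 1 / 8 := by
  have hhalf : closedBall (0 : Fin k → ℝ) (1 / 2) ⊆ ball 0 1 := closedBall_subset_ball (by norm_num)
  let S : Set (Fin n → ℝ) := a ⁻¹' (chi e '' closedBall 0 (1 / 2))
  have hS : IsClosed S := by
    refine IsClosed.preimage a.continuous (IsCompact.isClosed ?_)
    exact (isCompact_closedBall _ _).image_of_continuousOn
      ((continuousOn_chi e).mono (hhalf.trans ball_subset_closedBall))
  have hc : Continuous fun s : S => chiInv e (a s) := by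
    refine (continuousOn_chiInv e).comp_continuous (by fun_prop) fun s => ?_
    obtain ⟨y, hy, hys⟩ := s.2
    rw [← hys]; exact chi_mem_oCell e (hhalf hy)
  -- The coordinates make sense only on the closed set `S`; Tietze's theorem extends them to all of
  -- Euclidean space before smoothing.
  obtain ⟨f, hf⟩ := ContinuousMap.exists_restrict_eq hS (⟨_, hc⟩ : C(S, Fin k → ℝ))
  obtain ⟨g, hg, hgf, -⟩ := f.continuous.exists_contDiff_approx (ε := fun _ => 1 / 8) 1
    continuous_const (fun _ => by norm_num)
  refine ⟨g, by exact_mod_cast hg, fun y hy s hs => ?_⟩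
  have hy' : y ∈ closedBall (0 : Fin k → ℝ) (1 / 2) := by simpa using hy
  have hsS : s ∈ S := ⟨y, hy', hs.symm⟩
  have h1 : f s = y := by
    have := DFunLike.congr_fun hf ⟨s, hsS⟩
    simp only [ContinuousMap.restrict_apply, ContinuousMap.coe_mk] at this
    rw [this, hs, chiInv_chi e (hhalf hy')]
  rw [← h1, ← dist_eq_norm]
  exact hgf s

/-- A map from Euclidean space into a skeleton of larger dimension can be deformed away from the
centers of the top cells. -/
theorem exists_avoiding_centers (hnk : n < k) (a : C(Fin n → ℝ, X))
    (ha : ∀ s, a s ∈ skel X (k + 1)) :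
    ∃ A : C(I × (Fin n → ℝ), X), (∀ s, A (0, s) = a s) ∧ (∀ p, A p ∈ skel X (k + 1)) ∧
      (∀ t s, a s ∈ skel X k → A (t, s) = a s) ∧ ∀ s (e : Cell X k), A (1, s) ≠ chi e 0 := by
  have key : ∀ e : Cell X k, ∃ P : C(Fin n → ℝ, Fin k → ℝ), (∀ s, P s ≠ 0) ∧
      ∀ y : Fin k → ℝ, ‖y‖ ≤ 1 / 2 → ∀ s, a s = chi e y → ‖P s - y‖ < 1 / 4 := by
    intro e
    obtain ⟨g, hg, hga⟩ := exists_smooth_coordinates a e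
    -- The image of a differentiable map from a smaller dimension has dense complement; subtracting
    -- a small missed value `z` makes zero a missed value.
    obtain ⟨z, hz, hz'⟩ := (hg.dense_compl_range_of_finrank_lt_finrank (by simpa)).exists_mem_open
      isOpen_ball (⟨0, by simp⟩ : (ball (0 : Fin k → ℝ) (1 / 8)).Nonempty)
    refine ⟨⟨fun s => g s - z, hg.continuous.sub continuous_const⟩,
      fun s h0 => hz ⟨s, sub_eq_zero.1 h0⟩, fun y hy s hs => ?_⟩
    have h1 := hga y hy s hs
    rw [mem_ball_zero_iff] at hz'
    calc ‖g s - z - y‖ = ‖(g s - y) - z‖ := by congr 1; abel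
      _ ≤ ‖g s - y‖ + ‖z‖ := norm_sub_le _ _
      _ < 1 / 4 := by linarith
  choose P hP0 hP using key
  obtain ⟨A, h1, h2, h3, h4⟩ := exists_perturbation a ha P hP
  exact ⟨A, h1, h2, h3, fun s e hs => hP0 e s (h4 s e hs).1⟩

-- By Sard's theorem the critical values form a null set, and so does the image of the null set of
-- points with a rational coordinate. Irrational coordinates keep the preimages off the walls of
-- rational boxes.
open MeasureTheory in
lemma exists_regular_value (g : (Fin n → ℝ) → Fin n → ℝ) (hg : ContDiff ℝ 1 g) {ε : ℝ}
    (hε : 0 < ε) : ∃ z : Fin n → ℝ, ‖z‖ < ε ∧ ∀ s, g s = z →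
      (∀ i, Irrational (s i)) ∧ (fderiv ℝ g s).det ≠ 0 := by
  let W : Set (Fin n → ℝ) := {s | ∃ i, ¬ Irrational (s i)}
  let C : Set (Fin n → ℝ) := {s | (fderiv ℝ g s).det = 0}
  have hdiff : Differentiable ℝ g := hg.differentiable one_ne_zero
  have hW : volume W = 0 := by
    have : W ⊆ ⋃ (i : Fin n) (r : ℚ), {s : Fin n → ℝ | s i = r} := by
      rintro s ⟨i, hi⟩
      obtain ⟨r, hr⟩ := not_not.1 hi
      exact mem_iUnion₂.2 ⟨i, r, hr.symm⟩
    refine measure_mono_null this ?_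
    rw [measure_iUnion_null_iff]
    intro i
    rw [measure_iUnion_null_iff]
    intro r
    rw [volume_pi]
    exact Measure.pi_hyperplane _ i _
  have h1 : volume (g '' W) = 0 :=
    addHaar_image_eq_zero_of_differentiableOn_of_addHaar_eq_zero volume hdiff.differentiableOn hW
  have h2 : volume (g '' C) = 0 :=
    addHaar_image_eq_zero_of_det_fderivWithin_eq_zero volume
      (fun s _ => (hdiff s).hasFDerivAt.hasFDerivWithinAt) fun s hs => hs
  have h3 : ¬ ball (0 : Fin n → ℝ) ε ⊆ g '' W ∪ g '' C := fun hsub =>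
    (measure_ball_pos volume (0 : Fin n → ℝ) hε).ne'
      (measure_mono_null hsub (measure_union_null h1 h2))
  obtain ⟨z, hz, hz'⟩ := not_subset.1 h3
  refine ⟨z, by simpa using hz, fun s hs => ⟨fun i => ?_, fun h0 => ?_⟩⟩
  · by_contra hi
    exact hz' (.inl ⟨s, ⟨i, hi⟩, hs⟩)
  · exact hz' (.inr ⟨s, h0, hs⟩)

/-- A map from Euclidean space into a skeleton of the same dimension can be deformed so that the
centers of the top cells become regular values. -/
theorem exists_transverse (a : C(Fin n → ℝ, X)) (ha : ∀ s, a s ∈ skel X (n + 1)) :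
    ∃ A : C(I × (Fin n → ℝ), X), (∀ s, A (0, s) = a s) ∧ (∀ p, A p ∈ skel X (n + 1)) ∧
      (∀ t s, a s ∈ skel X n → A (t, s) = a s) ∧
      ∀ s (e : Cell X n), A (1, s) = chi e 0 → (∀ i, Irrational (s i)) ∧
        ∃ (q : (Fin n → ℝ) → Fin n → ℝ) (q' : (Fin n → ℝ) →L[ℝ] Fin n → ℝ), Continuous q ∧
          HasFDerivAt q q' s ∧ q s = 0 ∧ q'.det ≠ 0 ∧
          ∃ r > 0, ∀ v ∈ ball s r, ‖q v‖ < 1 ∧ A (1, v) = chi e (q v) := by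
  have key : ∀ e : Cell X n, ∃ P : C(Fin n → ℝ, Fin n → ℝ),
      (∀ s, P s = 0 → (∀ i, Irrational (s i)) ∧ ∃ q' : (Fin n → ℝ) →L[ℝ] Fin n → ℝ,
        HasFDerivAt P q' s ∧ q'.det ≠ 0) ∧
      ∀ y : Fin n → ℝ, ‖y‖ ≤ 1 / 2 → ∀ s, a s = chi e y → ‖P s - y‖ < 1 / 4 := by
    intro e
    obtain ⟨g, hg, hga⟩ := exists_smooth_coordinates a e
    obtain ⟨z, hz, hreg⟩ := exists_regular_value g hg (ε := 1 / 8) (by norm_num)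
    refine ⟨⟨fun s => g s - z, hg.continuous.sub continuous_const⟩,
      fun s h0 => ⟨(hreg s (sub_eq_zero.1 h0)).1, fderiv ℝ g s, ?_, (hreg s (sub_eq_zero.1 h0)).2⟩,
      fun y hy s hs => ?_⟩
    · exact ((hg.differentiable one_ne_zero) s).hasFDerivAt.sub_const z
    have h1 := hga y hy s hs
    calc ‖g s - z - y‖ = ‖(g s - y) - z‖ := by congr 1; abel
      _ ≤ ‖g s - y‖ + ‖z‖ := norm_sub_le _ _
      _ < 1 / 4 := by linarith
  choose P hP0 hP using key
  obtain ⟨A, h1, h2, h3, h4⟩ := exists_perturbation a ha P hP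
  refine ⟨A, h1, h2, h3, fun s e hs => ?_⟩
  obtain ⟨h5, h6⟩ := h4 s e hs
  obtain ⟨h7, q', h8, h9⟩ := hP0 e s h5
  exact ⟨h7, P e, q', (P e).continuous, h8, h5, h9, h6⟩

end Transverse

/-! ### The degree argument: cubes in the n-skeleton are governed by the n-cells. -/

section CellularDegree

variable {n : ℕ}

/-- The retraction of Euclidean space onto the unit cube. -/
noncomputable def clampCube (x : Fin n → ℝ) : Fin n → I := fun i => projIcc 0 1 zero_le_one (x i)

@[fun_prop]
lemma continuous_clampCube : Continuous (clampCube (n := n)) :=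
  continuous_pi fun i => continuous_projIcc.comp (continuous_apply i)

lemma clampCube_coe (s : Fin n → I) : clampCube (fun i => (s i : ℝ)) = s :=
  funext fun i => projIcc_val zero_le_one (s i)

lemma radial_one_smul {l : ℝ} (hl : 1 ≤ l) (y : Fin n → ℝ) : radial 1 (l • y) = radial l y := by
  have h0 : 0 ≤ l := zero_le_one.trans hl
  rw [radial, radial, norm_smul, Real.norm_of_nonneg h0, max_self, one_mul, max_eq_right hl,
    smul_smul]
  congr 1
  ring

lemma param_mem_Icc (J : BoxIntegral.Box (Fin n)) (s : Fin n → I) :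
    param J.lower J.upper s ∈ BoxIntegral.Box.Icc J := by
  have h i := (J.lower_lt_upper i).le
  have h0 i := (s i).2.1
  have h1 i := (s i).2.2
  refine ⟨fun i => ?_, fun i => ?_⟩ <;> simp only [param] <;> nlinarith [h i, h0 i, h1 i]

variable (n) in
/-- The unit cube as a box. -/
def unitBox : BoxIntegral.Box (Fin n) := ⟨fun _ => 0, fun _ => 1, fun _ => zero_lt_one⟩

lemma param_unitBox (s : Fin n → I) :
    param (unitBox n).lower (unitBox n).upper s = fun i => (s i : ℝ) := by
  funext i
  simp [param, unitBox]

/-- The corners of the box are rational. -/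
def RationalBox (J : BoxIntegral.Box (Fin n)) : Prop :=
  ∀ i, (∃ a : ℚ, (a : ℝ) = J.lower i) ∧ ∃ b : ℚ, (b : ℝ) = J.upper i

lemma RationalBox.splitCenterBox {J : BoxIntegral.Box (Fin n)} (h : RationalBox J)
    (S : Set (Fin n)) : RationalBox (J.splitCenterBox S) := by
  classical
  intro i
  obtain ⟨⟨a, ha⟩, ⟨b, hb⟩⟩ := h i
  have hm : (((a + b) / 2 : ℚ) : ℝ) = (J.lower i + J.upper i) / 2 := by push_cast; rw [ha, hb]
  constructor
  · by_cases hi : i ∈ S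
    · exact ⟨(a + b) / 2, by simpa [BoxIntegral.Box.splitCenterBox, hi] using hm⟩
    · exact ⟨a, by simpa [BoxIntegral.Box.splitCenterBox, hi] using ha⟩
  · by_cases hi : i ∈ S
    · exact ⟨b, by simpa [BoxIntegral.Box.splitCenterBox, hi] using hb⟩
    · exact ⟨(a + b) / 2, by simpa [BoxIntegral.Box.splitCenterBox, hi] using hm⟩

variable {X : Type*} [TopologicalSpace X] [T2Space X] [Topology.CWComplex (Set.univ : Set X)]

lemma radius_eq_zero {x : X} (hx : x ∈ skel X (n + 1)) (h : radius X n x = 0) :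
    ∃ e : Cell X n, x = chi e 0 := by
  rcases mem_skel_succ_iff.1 hx with hx | ⟨e, he⟩
  · rw [radius_of_mem_skel hx] at h
    exact absurd h one_ne_zero
  · refine ⟨e, ?_⟩
    rw [radius, modify_of_mem_oCell he] at h
    rw [← norm_eq_zero.1 h, chi_chiInv e he]

variable [Nonempty (Fin n)]
  {W : Type*} [TopologicalSpace W] {w : W} {Γ : Subgroup (HomotopyGroup (Fin n) W w)}

/-- Near a point `z` where `a` is transverse to the centers of the cells, the composition of `a`
with the expansion of the cells has its class in the subgroup on small boxes. -/
lemma exists_nhds_inSub {h : X → W} (hh : ContinuousOn h (skel X (n + 1)))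
    (hw : ∀ x ∈ skel X n, h x = w) (hcell : ∀ e : Cell X n, InSub Γ fun s => h (chi e (cubeToBall s)))
    (a : C(Fin n → ℝ, X)) (ha : ∀ s, a s ∈ skel X (n + 1)) (z : Fin n → ℝ)
    (hz : ∀ e : Cell X n, a z = chi e 0 → (∀ i : Fin n, Irrational (z i)) ∧
      ∃ (q : (Fin n → ℝ) → Fin n → ℝ) (q' : (Fin n → ℝ) →L[ℝ] Fin n → ℝ), Continuous q ∧
        HasFDerivAt q q' z ∧ q z = 0 ∧ q'.det ≠ 0 ∧
        ∃ r > 0, ∀ v ∈ ball z r, ‖q v‖ < 1 ∧ a v = chi e (q v)) :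
    ∃ U ∈ 𝓝 z, ∀ J : BoxIntegral.Box (Fin n), z ∈ BoxIntegral.Box.Icc J →
      BoxIntegral.Box.Icc J ⊆ U → RationalBox J →
      ∃ L : ℝ, ∀ l ≥ L, InSub Γ fun s => h (expand X n l (a (param J.lower J.upper s))) := by
  by_cases hc : ∃ e : Cell X n, a z = chi e 0
  · obtain ⟨e, he⟩ := hc
    obtain ⟨hirr, q, q', hqc, hq, hqz, hdet, r, hr, hball⟩ := hz e he
    -- The radial retraction extends the map on the cell to all of Euclidean space, with value `w`
    -- outside the open ball.
    let H : (Fin n → ℝ) → W := fun x => h (chi e (radial 1 x))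
    have hH : Continuous H := by
      refine hh.comp_continuous ((continuousOn_chi e).comp_continuous ?_ fun x => radial_mem _ _)
        fun x => chi_mem_skel e (radial_mem _ _)
      exact continuous_radial.comp (by fun_prop : Continuous fun x : Fin n → ℝ => ((1 : ℝ), x))
    have hHw : ∀ x, 1 ≤ ‖x‖ → H x = w := fun x hx => hw _ (chi_mem_skel_of_sphere e (by
      rw [mem_sphere_zero_iff_norm, norm_radial, max_self, one_mul, min_eq_left hx]))
    have hdeg : Deg Γ H cubeToBall := deg_cubeToBall hH hHw ((hcell e).congr fun s => by
      simp only [H]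
      rw [radial_one (mem_closedBall_zero_iff.1 (cubeToBall_mem s))])
    obtain ⟨r', hr', hloc⟩ := deg_local hH hHw hdeg hq hqz hdet
    refine ⟨ball z (min r r'), ball_mem_nhds z (lt_min hr hr'), fun J hzJ hJ hrat => ?_⟩
    have hpar s := hJ (param_mem_Icc J s)
    -- The corners are rational and the coordinates of `z` irrational, so `z` is interior to the
    -- box.
    obtain ⟨L, hL⟩ := hloc J.lower J.upper (fun i => by
      obtain ⟨⟨x, hx⟩, ⟨y, hy⟩⟩ := hrat i
      exact ⟨lt_of_le_of_ne (hzJ.1 i) fun h1 => hirr i ⟨x, hx.trans h1⟩,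
        lt_of_le_of_ne (hzJ.2 i) fun h1 => hirr i ⟨y, hy.trans h1.symm⟩⟩)
      (fun s => ball_subset_ball (min_le_right _ _) (hpar s)) hqc.continuousOn
    refine ⟨max L 1, fun l hl => (hL l (le_of_max_le_left hl)).congr fun s => ?_⟩
    obtain ⟨h1, h2⟩ := hball _ (ball_subset_ball (min_le_left _ _) (hpar s))
    simp only [H]
    rw [h2, expand_chi l e (mem_closedBall_zero_iff.2 h1.le),
      radial_one_smul (le_of_max_le_right hl)]
  -- When `a z` is not a center, the radius is bounded below near `z`, and a large expansion sends
  -- small boxes into `skel X n`, where `h` is constant.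
  · have hrad : Continuous fun v => radius X n (a v) :=
      continuousOn_radius.comp_continuous a.continuous ha
    have hpos : 0 < radius X n (a z) :=
      lt_of_le_of_ne (radius_nonneg _) fun h0 => hc (radius_eq_zero (ha z) h0.symm)
    refine ⟨{v | radius X n (a z) / 2 < radius X n (a v)},
      (isOpen_lt continuous_const hrad).mem_nhds (half_lt_self hpos), fun J hzJ hJ hrat =>
      ⟨(radius X n (a z) / 2)⁻¹, fun l hl => inSub_const fun s => hw _ ?_⟩⟩
    have h1 : radius X n (a z) / 2 < radius X n (a (param J.lower J.upper s)) :=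
      hJ (param_mem_Icc J s)
    refine expand_mem_skel_of_le (ha _) ?_
    have h2 : 0 < radius X n (a z) / 2 := half_pos hpos
    calc (1 : ℝ) = (radius X n (a z) / 2)⁻¹ * (radius X n (a z) / 2) := (inv_mul_cancel₀ h2.ne').symm
      _ ≤ _ := mul_le_mul hl h1.le h2.le ((inv_pos.2 h2).le.trans hl)

/-- If a map on the `n`-skeleton collapses the `(n - 1)`-skeleton and sends the `n`-cells into a
subgroup of the homotopy group, then it sends every relative cube into this subgroup. -/
theorem inSub_of_cells {h : X → W} (hh : ContinuousOn h (skel X (n + 1)))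
    (hw : ∀ x ∈ skel X n, h x = w) (hcell : ∀ e : Cell X n, InSub Γ fun s => h (chi e (cubeToBall s)))
    (a : C(Fin n → I, X)) (ha : ∀ s, a s ∈ skel X (n + 1))
    (hb : ∀ s ∈ Cube.boundary (Fin n), a s ∈ skel X n) : InSub Γ fun s => h (a s) := by
  classical
  obtain ⟨A, hA0, hAs, hAb, hA1⟩ :=
    exists_transverse (a.comp ⟨clampCube, continuous_clampCube⟩) fun s => ha _
  let a' : C(Fin n → ℝ, X) := A.comp ⟨fun v => (1, v), by fun_prop⟩
  have key : RationalBox (unitBox n) → ∃ L : ℝ, ∀ l ≥ L, InSub Γ fun s =>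
      h (expand X n l (a' (param (unitBox n).lower (unitBox n).upper s))) := by
    -- Repeated bisection reduces to boxes near a single point; at each cut the finitely many
    -- thresholds for the factor have a common bound.
    refine BoxIntegral.Box.subbox_induction_on' (p := fun J => RationalBox J → ∃ L : ℝ, ∀ l ≥ L,
      InSub Γ fun s => h (expand X n l (a' (param J.lower J.upper s)))) (unitBox n) ?_ ?_
    · intro J _ hJ hrat
      choose L hL using fun S => hJ S (hrat.splitCenterBox S)
      obtain ⟨M, hM⟩ := (Set.finite_range L).bddAbove
      exact ⟨M, fun l hl => InSub.of_splitCenterBox (b := fun v => h (expand X n l (a' v))) J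
        fun S => hL S l ((hM ⟨S, rfl⟩).trans hl)⟩
    · intro z _
      obtain ⟨U, hU, hJ⟩ := exists_nhds_inSub hh hw hcell a' (fun s => hAs _) z (hA1 z)
      exact ⟨U, mem_nhdsWithin_of_mem_nhds hU, fun J _ _ hz hJU _ => hJ J hz hJU⟩
  obtain ⟨L, hL⟩ := key fun i => ⟨⟨0, by simp [unitBox]⟩, ⟨1, by simp [unitBox]⟩⟩
  have h1 := hL (max L 1) (le_max_left _ _)
  simp only [param_unitBox] at h1
  have hAb' : ∀ (t : I), ∀ s ∈ Cube.boundary (Fin n), A (t, fun i => (s i : ℝ)) ∈ skel X n := by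
    intro t s hs
    have : (a.comp ⟨clampCube, continuous_clampCube⟩) (fun i => (s i : ℝ)) = a s :=
      congrArg a (clampCube_coe s)
    rw [hAb t _ (by rw [this]; exact hb s hs), this]
    exact hb s hs
  -- The expansion is undone by letting the factor return to `1`; the boundary remains in `skel X
  -- n`, where `h` equals `w`.
  have h2 : InSub Γ fun s : Fin n → I => h (a' fun i => (s i : ℝ)) := by
    refine h1.homotopy (H := fun p : I × (Fin n → I) =>
      h (expand X n (1 + (1 - (p.1 : ℝ)) * (max L 1 - 1)) (a' fun i => (p.2 i : ℝ)))) ?_ ?_ ?_ ?_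
    · refine hh.comp_continuous (continuousOn_expand.comp_continuous (f := fun p : I × (Fin n → I) =>
        ((1 + (1 - (p.1 : ℝ)) * (max L 1 - 1) : ℝ), a' fun i => (p.2 i : ℝ))) (by fun_prop)
        fun p => ⟨mem_univ _, hAs _⟩) fun p => expand_mem_skel _ (hAs _)
    · intro s; simp
    · intro s
      simp only [Icc.coe_one, sub_self, zero_mul, add_zero]
      rw [expand_one (show a' _ ∈ _ from hAs _)]
    · intro t s hs
      have : a' (fun i => (s i : ℝ)) ∈ skel X n := hAb' 1 s hs
      simp only
      rw [expand_of_mem_skel _ this]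
      exact hw _ this
  -- Next the transversality deformation is run backwards.
  refine h2.homotopy (H := fun p : I × (Fin n → I) =>
      h (A (unitInterval.symm p.1, fun i => (p.2 i : ℝ)))) ?_ ?_ ?_ ?_
  · exact hh.comp_continuous (by fun_prop) fun p => hAs _
  · intro s; simp [a']
  · intro s
    simp only [unitInterval.symm_one]
    rw [hA0]
    exact congrArg (fun s => h (a s)) (clampCube_coe s)
  · intro t s hs
    exact hw _ (hAb' _ s hs)

end CellularDegree

/-! ### Cellular approximation for cubes. -/

section CellularApproximation

variable {n : ℕ}
  {X : Type*} [TopologicalSpace X] [T2Space X] [Topology.CWComplex (Set.univ : Set X)]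

/-- Once the centers are avoided, the radius has a positive minimum on the compact cube, and
expansion by its inverse ends in `skel X k`. -/
lemma exists_homotopicRel_skel_of_lt {k : ℕ} (hnk : n < k) (a : C(Fin n → I, X))
    (ha : ∀ s, a s ∈ skel X (k + 1)) (hb : ∀ s ∈ Cube.boundary (Fin n), a s ∈ skel X k) :
    ∃ a' : C(Fin n → I, X), a.HomotopicRel a' (Cube.boundary (Fin n)) ∧ ∀ s, a' s ∈ skel X k := by
  obtain ⟨A, hA0, hAs, hAb, hA1⟩ :=
    exists_avoiding_centers hnk (a.comp ⟨clampCube, continuous_clampCube⟩) fun s => ha _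
  have hcl : ∀ s : Fin n → I, (a.comp ⟨clampCube, continuous_clampCube⟩) (fun i => (s i : ℝ)) = a s :=
    fun s => congrArg a (clampCube_coe s)
  have hAb' : ∀ (t : I), ∀ s ∈ Cube.boundary (Fin n), A (t, fun i => (s i : ℝ)) = a s := by
    intro t s hs
    rw [hAb t _ (by rw [hcl]; exact hb s hs), hcl]
  let a₁ : C(Fin n → I, X) := A.comp ⟨fun s => (1, fun i => (s i : ℝ)), by fun_prop⟩
  have h1 : a.HomotopicRel a₁ (Cube.boundary (Fin n)) :=
    ⟨⟨⟨⟨fun p => A (p.1, fun i => (p.2 i : ℝ)), by fun_prop⟩, fun s => by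
      simp only
      rw [hA0, hcl], fun s => rfl⟩, fun t s hs => hAb' t s hs⟩⟩
  have hrad : Continuous fun s => radius X k (a₁ s) :=
    continuousOn_radius.comp_continuous a₁.continuous fun s => hAs _
  obtain ⟨s₀, -, hs₀⟩ := isCompact_univ.exists_isMinOn univ_nonempty hrad.continuousOn
  have hpos : 0 < radius X k (a₁ s₀) := lt_of_le_of_ne (radius_nonneg _) fun h0 => by
    obtain ⟨e, he⟩ := radius_eq_zero (hAs _) h0.symm
    exact hA1 _ e he
  let l := (radius X k (a₁ s₀))⁻¹
  have hcont : Continuous fun p : I × (Fin n → I) =>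
      expand X k (1 + (p.1 : ℝ) * (l - 1)) (a₁ p.2) :=
    continuousOn_expand.comp_continuous (f := fun p : I × (Fin n → I) =>
      ((1 + (p.1 : ℝ) * (l - 1) : ℝ), a₁ p.2)) (by fun_prop) fun p => ⟨mem_univ _, hAs _⟩
  let a₂ : C(Fin n → I, X) := ⟨fun s => expand X k l (a₁ s),
    continuousOn_expand.comp_continuous (f := fun s => (l, a₁ s)) (by fun_prop)
      fun p => ⟨mem_univ _, hAs _⟩⟩
  have h2 : a₁.HomotopicRel a₂ (Cube.boundary (Fin n)) := by
    refine ⟨⟨⟨⟨_, hcont⟩, fun s => ?_, fun s => ?_⟩, fun t s hs => ?_⟩⟩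
    · simp only [Icc.coe_zero, zero_mul, add_zero]
      exact expand_one (hAs _)
    · simp [a₂]
    · have : a₁ s ∈ skel X k := by
        change A (1, _) ∈ _
        rw [hAb' 1 s hs]
        exact hb s hs
      exact expand_of_mem_skel _ this
  refine ⟨a₂, h1.trans h2, fun s => expand_mem_skel_of_le (hAs _) ?_⟩
  have h3 : radius X k (a₁ s₀) ≤ radius X k (a₁ s) := hs₀ (mem_univ s)
  calc (1 : ℝ) = l * radius X k (a₁ s₀) := (inv_mul_cancel₀ hpos.ne').symm
    _ ≤ _ := by gcongr

/-- A cube with boundary in the `n`-skeleton can be deformed into the `n`-skeleton. -/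
theorem exists_homotopicRel_skel (a : C(Fin n → I, X))
    (hb : ∀ s ∈ Cube.boundary (Fin n), a s ∈ skel X (n + 1)) :
    ∃ a' : C(Fin n → I, X), a.HomotopicRel a' (Cube.boundary (Fin n)) ∧
      ∀ s, a' s ∈ skel X (n + 1) := by
  obtain ⟨k, hk⟩ := exists_subset_skel_of_isCompact (isCompact_range a.continuous)
  -- By compactness the image lies in some skeleton; the dimension is then lowered one step at a
  -- time.
  have key : ∀ j, ∀ a : C(Fin n → I, X), (∀ s, a s ∈ skel X (n + 1 + j)) →
      (∀ s ∈ Cube.boundary (Fin n), a s ∈ skel X (n + 1)) →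
      ∃ a' : C(Fin n → I, X), a.HomotopicRel a' (Cube.boundary (Fin n)) ∧
        ∀ s, a' s ∈ skel X (n + 1) := by
    intro j
    induction j with
    | zero => exact fun a ha _ => ⟨a, .refl a, ha⟩
    | succ j ih =>
      intro a ha hb
      obtain ⟨a₁, h1, h1s⟩ := exists_homotopicRel_skel_of_lt (by omega : n < n + 1 + j) a ha
        fun s hs => skel_mono (by omega) (hb s hs)
      obtain ⟨a₂, h2, h2s⟩ := ih a₁ h1s fun s hs => by
        obtain ⟨F⟩ := h1
        rw [← F.apply_one, F.eq_fst 1 hs]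
        exact hb s hs
      exact ⟨a₂, h1.trans h2, h2s⟩
  exact key k a (fun s => skel_mono (by omega) (hk ⟨s, rfl⟩)) hb

end CellularApproximation

/-! ### Induced homomorphisms and the graph subgroup. -/

section InducedHom

open Topology.Homotopy

variable {n : ℕ} {W Z : Type*} [TopologicalSpace W] [TopologicalSpace Z] {w : W} {z : Z}

/-- The composition of a generalized loop with a pointed map. -/
def mapLoop (F : C(W, Z)) (hF : F w = z) (p : Ω^ (Fin n) W w) : Ω^ (Fin n) Z z :=
  ⟨F.comp p.1, fun s hs => (congrArg F (p.2 s hs)).trans hF⟩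

variable [Nonempty (Fin n)]

/-- The homomorphism of homotopy groups induced by a pointed map. -/
noncomputable def inducedHom (F : C(W, Z)) (hF : F w = z) :
    HomotopyGroup (Fin n) W w →* HomotopyGroup (Fin n) Z z :=
  MonoidHom.mk' (Quotient.map (mapLoop F hF) fun _ _ h => h.comp_continuousMap F) <| by
    intro a b
    obtain ⟨p, rfl⟩ := piClass_surjective a
    obtain ⟨q, rfl⟩ := piClass_surjective b
    let i := Classical.arbitrary (Fin n)
    rw [piClass_mul i]
    change piClass (mapLoop F hF _) = piClass (mapLoop F hF p) * piClass (mapLoop F hF q)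
    rw [piClass_mul i]
    congr 1
    ext s
    change F (if _ then _ else _) = if _ then F _ else F _
    split_ifs <;> rfl

lemma inducedHom_piClass (F : C(W, Z)) (hF : F w = z) (p : Ω^ (Fin n) W w) :
    inducedHom F hF (piClass p) = piClass (mapLoop F hF p) := rfl

/-- The subgroup of the homotopy group of a product corresponding to the graph of `φ`. -/
noncomputable def graphSubgroup (φ : HomotopyGroup (Fin n) W w →* HomotopyGroup (Fin n) Z z) :
    Subgroup (HomotopyGroup (Fin n) (W × Z) (w, z)) :=
  (φ.comp (inducedHom ContinuousMap.fst rfl)).eqLocus (inducedHom ContinuousMap.snd rfl)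

variable {φ : HomotopyGroup (Fin n) W w →* HomotopyGroup (Fin n) Z z}

lemma inSub_graphSubgroup {p : Ω^ (Fin n) W w} {q : Ω^ (Fin n) Z z}
    (h : φ (piClass p) = piClass q) : InSub (graphSubgroup φ) fun s => (p s, q s) := by
  refine ⟨⟨p.1.prodMk q.1, fun s hs => Prod.ext (p.2 s hs) (q.2 s hs)⟩, fun s => rfl, ?_⟩
  exact h

lemma InSub.map_piClass_eq {a : (Fin n → I) → W} {b : (Fin n → I) → Z}
    (h : InSub (graphSubgroup φ) fun s => (a s, b s)) {p : Ω^ (Fin n) W w} {q : Ω^ (Fin n) Z z}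
    (hp : ∀ s, p s = a s) (hq : ∀ s, q s = b s) : φ (piClass p) = piClass q := by
  obtain ⟨c, hc, hmem⟩ := h
  have h1 : mapLoop ContinuousMap.fst rfl c = p := by
    ext s
    exact (congrArg Prod.fst (hc s)).trans (hp s).symm
  have h2 : mapLoop ContinuousMap.snd rfl c = q := by
    ext s
    exact (congrArg Prod.snd (hc s)).trans (hq s).symm
  rw [← h1, ← h2]
  exact hmem

end InducedHom

/-! ### Collapsing the lower skeleton. -/

section Collapse

variable {X : Type*} [TopologicalSpace X] [T2Space X] [Topology.CWComplex (Set.univ : Set X)]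

lemma exists_chi_eq_of_mem_skel {k : ℕ} {x : X} (hx : x ∈ skel X k) :
    ∃ m < k, ∃ (e : Cell X m) (y : Fin m → ℝ), y ∈ closedBall (0 : Fin m → ℝ) 1 ∧ chi e y = x := by
  obtain ⟨m, hm, e, he⟩ := mem_skel_iff.1 hx
  exact ⟨m, hm, e, chiInv e x, ball_subset_closedBall (chiInv_mem e he), chi_chiInv e he⟩

lemma exists_chi_eq (x : X) :
    ∃ (m : ℕ) (e : Cell X m) (y : Fin m → ℝ), y ∈ closedBall (0 : Fin m → ℝ) 1 ∧ chi e y = x := by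
  obtain ⟨k, hk⟩ := iUnion_skel x
  obtain ⟨m, -, h⟩ := exists_chi_eq_of_mem_skel hk
  exact ⟨m, h⟩

lemma continuousOn_comp_chi_sphere {E : Type*} [TopologicalSpace E] {k : ℕ} {g : X → E}
    (hg : ContinuousOn g (skel X k)) (e : Cell X k) :
    ContinuousOn (fun y => g (chi e y)) (sphere 0 1) :=
  hg.comp ((continuousOn_chi e).mono sphere_subset_closedBall) fun _ hy => chi_mem_skel_of_sphere e hy

/-- If the homotopy groups of `X` below degree `n` are trivial, then the identity is homotopic
to a map collapsing the `(n - 1)`-skeleton to a vertex. -/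
theorem exists_collapse [PathConnectedSpace X] {n : ℕ} {x₀ : X} (hx₀ : x₀ ∈ skel X 1)
    (h : ∀ k < n, Subsingleton (HomotopyGroup (Fin k) X x₀)) :
    ∃ R : C(X, C(I, X)), (∀ x, R x 0 = x) ∧ (∀ x ∈ skel X n, R x 1 = x₀) ∧
      R x₀ = ContinuousMap.const I x₀ := by
  have : Nonempty C(I, X) := ⟨ContinuousMap.const I x₀⟩
  -- The homotopy is built as a map into the path space: `R x` is the track of `x`.
  obtain ⟨R, hR⟩ := exists_continuous_of_cells (X := X) (E := C(I, X))
    (fun k e u => (∀ y ∈ closedBall (0 : Fin k → ℝ) 1, u y 0 = chi e y) ∧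
      (k < n → ∀ y ∈ closedBall (0 : Fin k → ℝ) 1, u y 1 = x₀) ∧
      (k = 0 → ∀ y ∈ closedBall (0 : Fin k → ℝ) 1, chi e y = x₀ → u y = ContinuousMap.const I x₀))
    (fun k e u v huv hu => ⟨fun y hy => by rw [← huv hy]; exact hu.1 y hy,
      fun hk y hy => by rw [← huv hy]; exact hu.2.1 hk y hy,
      fun hk y hy => by rw [← huv hy]; exact hu.2.2 hk y hy⟩) <| by
    intro k g hg hlow e
    have hu := continuousOn_comp_chi_sphere hg e
    have hg0 : ∀ y ∈ sphere (0 : Fin k → ℝ) 1, g (chi e y) 0 = chi e y := by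
      intro y hy
      obtain ⟨m, hm, e', y', hy', he'⟩ := exists_chi_eq_of_mem_skel (chi_mem_skel_of_sphere e hy)
      rw [← he']
      exact (hlow m hm e').1 y' hy'
    -- The vertex `x₀` gets the constant track, which makes the homotopy pointed.
    by_cases hvert : k = 0 ∧ chi e 0 = x₀
    · obtain ⟨rfl, he⟩ := hvert
      have he' : ∀ y, chi e y = x₀ := fun y => by rw [Subsingleton.elim y 0, he]
      refine ⟨fun _ => ContinuousMap.const I x₀, continuousOn_const, fun y hy => ?_,
        fun y _ => (he' y).symm, fun _ _ _ => rfl, fun _ _ _ _ => rfl⟩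
      rw [Subsingleton.elim y 0, mem_sphere_zero_iff_norm, norm_zero] at hy
      exact absurd hy zero_ne_one
    have hlast : ∀ u : (Fin k → ℝ) → C(I, X), k = 0 → ∀ y ∈ closedBall (0 : Fin k → ℝ) 1,
        chi e y = x₀ → u y = ContinuousMap.const I x₀ := by
      rintro u rfl y - hy
      exact absurd ⟨rfl, by rw [← hy, Subsingleton.elim y 0]⟩ hvert
    by_cases hk : k < n
    -- The obstruction over a `k`-cell lies in the homotopy group of degree `k`. From dimension `n`
    -- on, no end value is prescribed and homotopy extension suffices.
    · obtain ⟨w, hw, hwu, hw'⟩ := (extendsOverBall_of_subsingleton x₀ (h k hk)).exists_homotopy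
        hu (continuousOn_chi e) (continuousOn_const (c := x₀)) hg0 fun y hy => by
          obtain ⟨m, hm, e', y', hy', he'⟩ :=
            exists_chi_eq_of_mem_skel (chi_mem_skel_of_sphere e hy)
          rw [← he']
          exact (hlow m hm e').2.1 (hm.trans hk) y' hy'
      exact ⟨w, hw, hwu, fun y hy => (hw' y hy).1, fun _ y hy => (hw' y hy).2, hlast w⟩
    · obtain ⟨w, hw, hwu, hw'⟩ := ball_homotopy_extension hu (continuousOn_chi e) hg0
      exact ⟨w, hw, hwu, hw', fun hk' => absurd hk' hk, hlast w⟩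
  refine ⟨R, fun x => ?_, fun x hx => ?_, ?_⟩
  · obtain ⟨m, e, y, hy, rfl⟩ := exists_chi_eq x
    exact (hR m e).1 y hy
  · obtain ⟨m, hm, e, y, hy, rfl⟩ := exists_chi_eq_of_mem_skel hx
    exact (hR m e).2.1 hm y hy
  · obtain ⟨m, hm, e, y, hy, he⟩ := exists_chi_eq_of_mem_skel hx₀
    have := (hR m e).2.2 (Nat.lt_one_iff.1 hm) y hy he
    simpa only [he] using this

end Collapse

/-! ### Extension over the (n + 1)-cells. -/

section Attach

open Topology.Homotopy

variable {n : ℕ} [Nonempty (Fin n)]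
  {X : Type*} [TopologicalSpace X] [T2Space X] [Topology.CWComplex (Set.univ : Set X)]
  {Y Z : Type*} [TopologicalSpace Y] [TopologicalSpace Z] {y₀ : Y} {z₀ : Z}
  {φ : HomotopyGroup (Fin n) Z z₀ →* HomotopyGroup (Fin n) Y y₀}

/-- A point of an open `n`-cell is joined by a segment to a frontier point, which exists because `n`
is positive. -/
lemma exists_path_to_skel (x : skel X (n + 1)) :
    ∃ (x' : skel X (n + 1)) (_ : Path x x'), x'.1 ∈ skel X n := by
  obtain ⟨x, hx⟩ := x
  rcases mem_skel_succ_iff.1 hx with hxn | ⟨e, he⟩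
  · exact ⟨⟨x, hx⟩, Path.refl _, hxn⟩
  let y := chiInv e x
  have hy : y ∈ closedBall (0 : Fin n → ℝ) 1 := ball_subset_closedBall (chiInv_mem e he)
  let y' : Fin n → ℝ := fun _ => 1
  have hy' : y' ∈ sphere (0 : Fin n → ℝ) 1 := by
    rw [mem_sphere_zero_iff_norm, pi_norm_const, norm_one]
  let c : I → Fin n → ℝ := fun t => (1 - (t : ℝ)) • y + (t : ℝ) • y'
  have hc : ∀ t, c t ∈ closedBall (0 : Fin n → ℝ) 1 := fun t =>
    (convex_closedBall _ _) hy (sphere_subset_closedBall hy') (sub_nonneg.2 t.2.2) t.2.1 (by ring)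
  refine ⟨⟨chi e y', chi_mem_skel e (sphere_subset_closedBall hy')⟩,
    ⟨⟨fun t => ⟨chi e (c t), chi_mem_skel e (hc t)⟩, Continuous.subtype_mk
      ((continuousOn_chi e).comp_continuous (by fun_prop) hc) _⟩, Subtype.ext ?_, Subtype.ext ?_⟩,
    chi_mem_skel_of_sphere e hy'⟩
  · simp only [c, Icc.coe_zero, sub_zero, one_smul, zero_smul, add_zero]
    exact chi_chiInv e he
  · simp [c]

/-- If `g` realizes `φ` on the `n`-cells relative to a map `r` defined on the whole complex, then
`g` extends over the `(n + 1)`-cells. -/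
theorem exists_extension_of_inSub {r : X → Z} {g : X → Y} (hr : Continuous r)
    (hg : ContinuousOn g (skel X (n + 1))) (hrz : ∀ x ∈ skel X n, r x = z₀)
    (hgy : ∀ x ∈ skel X n, g x = y₀)
    (hcell : ∀ e : Cell X n, InSub (graphSubgroup φ)
      fun s => (r (chi e (cubeToBall s)), g (chi e (cubeToBall s)))) (e : Cell X (n + 1)) :
    ∃ v, ContinuousOn v (closedBall 0 1) ∧ EqOn v (fun y => g (chi e y)) (sphere 0 1) := by
  have hth (s : Fin n → I) : chi e (theta (cubeToBall s)) ∈ skel X (n + 1) :=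
    chi_mem_skel_of_sphere e (theta_cubeToBall_mem s)
  let b : C(Fin n → I, skel X (n + 1)) := ⟨fun s => ⟨chi e (theta (cubeToBall s)), hth s⟩,
    Continuous.subtype_mk ((continuousOn_chi e).comp_continuous (continuous_theta.comp continuous_cubeToBall)
      fun s => sphere_subset_closedBall (theta_cubeToBall_mem s)) _⟩
  have hb1 : ∀ s ∈ Cube.boundary (Fin n), theta (cubeToBall s) = pole n := fun s hs =>
    theta_of_norm_eq_one ((mem_boundary_iff s).1 hs)
  have hpole : chi e (pole n) ∈ skel X (n + 1) := by
    rw [← hb1 (fun _ => 0) ⟨Classical.arbitrary _, .inl rfl⟩]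
    exact hth _
  have hb : ∀ s ∈ Cube.boundary (Fin n), b s = ⟨chi e (pole n), hpole⟩ := fun s hs =>
    Subtype.ext (congrArg (chi e) (hb1 s hs))
  -- The base point of the attaching sphere may lie inside an `n`-cell; it is dragged to `skel X n`,
  -- where `r` and `g` take the values `z₀` and `y₀`.
  obtain ⟨x', γ, hx'⟩ := exists_path_to_skel (⟨chi e (pole n), hpole⟩ : skel X (n + 1))
  obtain ⟨c, hcb, hbc⟩ := exists_drag γ b hb
  let rS : C(skel X (n + 1), Z) := ⟨fun x => r x, hr.comp continuous_subtype_val⟩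
  let gS : C(skel X (n + 1), Y) := ⟨fun x => g x, hg.domRestrict⟩
  let p : Ω^ (Fin n) Z z₀ := ⟨rS.comp c, fun s hs => by
    change r (c s) = z₀
    rw [hcb s hs]
    exact hrz _ hx'⟩
  let q : Ω^ (Fin n) Y y₀ := ⟨gS.comp c, fun s hs => by
    change g (c s) = y₀
    rw [hcb s hs]
    exact hgy _ hx'⟩
  have hpq : φ (piClass p) = piClass q := by
    have := inSub_of_cells (Γ := graphSubgroup φ) (h := fun x => (r x, g x))
      (hr.continuousOn.prodMk hg) (fun x hx => Prod.ext (hrz x hx) (hgy x hx)) hcell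
      ⟨fun s => (c s : X), by fun_prop⟩ (fun s => (c s).2) fun s hs => by
        change (c s : X) ∈ _
        rw [hcb s hs]
        exact hx'
    exact this.map_piClass_eq (fun s => rfl) fun s => rfl
  -- The attaching sphere becomes null after `r`, because `r` is defined on the whole cell `e`.
  have hp1 : piClass p = 1 := by
    rw [← piClass_const, piClass_eq_iff]
    have h1 := drag_of_ball_extension (R := fun y => r (chi e y))
      (hr.comp_continuousOn (continuousOn_chi e)) (a := rS.comp b) fun s => rfl
    have h2 := (h1.homotopicRel (.refl _)).symm
    have h3 := (drag_const (k := n) (γ.map rS.continuous)).homotopic_unique (hbc.comp rS) h2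
      fun s hs => rfl
    have h4 : ContinuousMap.const (Fin n → I) (rS x') =
        (GenLoop.const : Ω^ (Fin n) Z z₀).1 := by
      ext s
      exact hrz _ hx'
    rw [h4] at h3
    exact h3.symm
  rw [hp1, map_one, ← piClass_const, eq_comm, piClass_eq_iff] at hpq
  have h5 : (GenLoop.const : Ω^ (Fin n) Y y₀).1 = ContinuousMap.const (Fin n → I) (gS x') := by
    ext s
    exact (hgy _ hx').symm
  rw [h5] at hpq
  refine exists_ball_extension_of_drag (u := fun y => g (chi e y)) (a := gS.comp b) (fun s => rfl)
    ((hbc.comp gS).trans (Drag.of_homotopicRel (y := gS x') hpq fun s hs => ?_))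
  exact congrArg gS (hcb s hs)

end Attach

/-! ### Existence and uniqueness of maps inducing a given homomorphism. -/

section Realization

open Topology.Homotopy

variable {n : ℕ} [Nonempty (Fin n)]
  {X : Type*} [TopologicalSpace X] [T2Space X] [Topology.CWComplex (Set.univ : Set X)]
  [PathConnectedSpace X] {x₀ : X}
  {Y : Type*} [TopologicalSpace Y] [PathConnectedSpace Y] {y₀ : Y}

lemma skel_one_subset : skel X 1 ⊆ skel X n :=
  skel_mono (Fin.pos_iff_nonempty.2 inferInstance)

/-- The generalized loop given by an `n`-cell and a map collapsing the `(n - 1)`-skeleton. -/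
def cellLoop (r : C(X, X)) (hr : ∀ x ∈ skel X n, r x = x₀) (e : Cell X n) : Ω^ (Fin n) X x₀ :=
  ⟨⟨fun s => r (chi e (cubeToBall s)), r.continuous.comp
    ((continuousOn_chi e).comp_continuous continuous_cubeToBall cubeToBall_mem)⟩, fun s hs =>
      hr _ (chi_mem_skel_of_sphere e (mem_sphere_zero_iff_norm.2 ((mem_boundary_iff s).1 hs)))⟩

/-- Every homomorphism from the first nontrivial homotopy group of a CW complex to the last
nontrivial homotopy group of a space is induced by a map. -/
theorem exists_map_inducing (hx₀ : x₀ ∈ skel X 1)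
    (hX : ∀ k < n, Subsingleton (HomotopyGroup (Fin k) X x₀))
    (hY : ∀ k > n, Subsingleton (HomotopyGroup (Fin k) Y y₀))
    (φ : HomotopyGroup (Fin n) X x₀ →* HomotopyGroup (Fin n) Y y₀) :
    ∃ (f : C(X, Y)) (hf : f x₀ = y₀), ∀ p : Ω^ (Fin n) X x₀,
      φ (piClass p) = piClass (mapLoop f hf p) := by
  obtain ⟨R, hR0, hR1, hRx⟩ := exists_collapse hx₀ hX
  let r : C(X, X) := ⟨fun x => R x 1, by fun_prop⟩
  have hr : ∀ x ∈ skel X n, r x = x₀ := hR1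
  have : Nonempty Y := ⟨y₀⟩
  -- Lower cells go to `y₀`, and on `n`-cells the pair formed by `r` and the new map must represent
  -- an element of the graph of `φ`. The cast transports the cube along `k = n`.
  obtain ⟨f, hf⟩ := exists_continuous_of_cells (X := X) (E := Y)
    (fun k e u => (k < n → ∀ y ∈ closedBall (0 : Fin k → ℝ) 1, u y = y₀) ∧
      ∀ hk : k = n, InSub (graphSubgroup φ) fun s : Fin n → I =>
        (r (chi e (cubeToBall fun i => s (Fin.cast hk i))),
          u (cubeToBall fun i => s (Fin.cast hk i))))
    (fun k e u v huv hu => ⟨fun hk y hy => by rw [← huv hy]; exact hu.1 hk y hy,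
      fun hk => (hu.2 hk).congr fun s => by rw [huv (cubeToBall_mem _)]⟩) <| by
    intro k g hg hlow e
    rcases lt_trichotomy k n with hk | rfl | hk
    · refine ⟨fun _ => y₀, continuousOn_const, fun y hy => ?_, fun _ _ _ => rfl,
        fun hk' => absurd hk' hk.ne⟩
      obtain ⟨m, hm, e', y', hy', he'⟩ := exists_chi_eq_of_mem_skel (chi_mem_skel_of_sphere e hy)
      rw [← he']
      exact ((hlow m hm e').1 (hm.trans hk) y' hy').symm
    · obtain ⟨q, hq⟩ := piClass_surjective (φ (piClass (cellLoop r hr e)))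
      refine ⟨fun y => q (ballToCube y), (q.1.continuous.comp continuous_ballToCube).continuousOn,
        fun y hy => ?_, fun hk => absurd hk (lt_irrefl _), fun _ => ?_⟩
      · obtain ⟨m, hm, e', y', hy', he'⟩ :=
          exists_chi_eq_of_mem_skel (chi_mem_skel_of_sphere e hy)
        rw [← he']
        exact (q.2 _ (ballToCube_mem_boundary hy)).trans ((hlow m hm e').1 hm y' hy').symm
      · refine (inSub_graphSubgroup hq.symm).congr fun s => Prod.ext rfl ?_
        change q s = q (ballToCube (cubeToBall s))
        rw [ballToCube_cubeToBall]
    · obtain ⟨k, rfl⟩ : ∃ j, k = j + 1 := ⟨k - 1, by omega⟩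
      have hlast : ∀ v : (Fin (k + 1) → ℝ) → Y,
          (k + 1 < n → ∀ y ∈ closedBall (0 : Fin (k + 1) → ℝ) 1, v y = y₀) ∧
          ∀ hk : k + 1 = n, InSub (graphSubgroup φ) fun s : Fin n → I =>
            (r (chi e (cubeToBall fun i => s (Fin.cast hk i))),
              v (cubeToBall fun i => s (Fin.cast hk i))) :=
        fun v => ⟨fun hk' => absurd hk' hk.not_gt, fun hk' => absurd hk' hk.ne'⟩
      -- A cell of dimension `k + 1` is attached along a `k`-sphere: `k = n` is the graph argument,
      -- and for `k > n` the homotopy group of `Y` vanishes.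
      rcases (Nat.lt_succ_iff.1 hk).eq_or_lt with rfl | hk'
      · obtain ⟨v, hv, hvu⟩ := exists_extension_of_inSub (φ := φ) r.continuous hg hr
          (fun x hx => by
            obtain ⟨m, hm, e', y', hy', rfl⟩ := exists_chi_eq_of_mem_skel hx
            exact (hlow m (hm.trans (Nat.lt_succ_self _)) e').1 hm y' hy')
          (fun e' => (hlow _ (Nat.lt_succ_self _) e').2 rfl) e
        exact ⟨v, hv, hvu, hlast v⟩
      · obtain ⟨v, hv, hvu⟩ := extendsOverBall_of_subsingleton y₀ (hY k hk') _
          (continuousOn_comp_chi_sphere hg e)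
        exact ⟨v, hv, hvu, hlast v⟩
  have hfy : ∀ x ∈ skel X n, f x = y₀ := by
    intro x hx
    obtain ⟨m, hm, e, y, hy, rfl⟩ := exists_chi_eq_of_mem_skel hx
    exact (hf m e).1 hm y hy
  have hx₀n : x₀ ∈ skel X n := skel_one_subset hx₀
  refine ⟨f, hfy _ hx₀n, fun p => ?_⟩
  -- An arbitrary loop is first moved into the `n`-skeleton, so that the knowledge about cells
  -- applies to it.
  obtain ⟨a, hpa, ha⟩ := exists_homotopicRel_skel p.1 fun s hs => by
    rw [show p.1 s = x₀ from p.2 s hs]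
    exact skel_mono (Nat.le_succ n) hx₀n
  have hab : ∀ s ∈ Cube.boundary (Fin n), a s = x₀ := fun s hs => by
    obtain ⟨F⟩ := hpa
    rw [← F.apply_one, F.eq_fst 1 hs]
    exact p.2 s hs
  let p' : Ω^ (Fin n) X x₀ := ⟨a, hab⟩
  have h1 : piClass p = piClass p' := piClass_eq_iff.2 hpa
  have h2 := inSub_of_cells (Γ := graphSubgroup φ) (h := fun x => (r x, f x))
    (by fun_prop) (fun x hx => Prod.ext (hr x hx) (hfy x hx)) (fun e => (hf n e).2 rfl) a ha
    fun s hs => by rw [hab s hs]; exact hx₀n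
  have h3 := h2.map_piClass_eq (p := mapLoop r (hr _ hx₀n) p') (q := mapLoop f (hfy _ hx₀n) p')
    (fun s => rfl) fun s => rfl
  have h4 : piClass p' = piClass (mapLoop r (hr _ hx₀n) p') := by
    refine piClass_eq_iff.2 ⟨⟨⟨⟨fun ts => R (a ts.2) ts.1, by fun_prop⟩, fun s => hR0 _,
      fun s => rfl⟩, fun t s hs => ?_⟩⟩
    change R (a s) t = a s
    rw [hab s hs, hRx]
    rfl
  rw [← inducedHom_piClass, h1, inducedHom_piClass, h4, h3]

/-- Two maps from a CW complex inducing the same homomorphism between the first nontrivial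
homotopy group of the source and the last nontrivial one of the target are homotopic. -/
theorem homotopicRel_of_piClass_eq (hx₀ : x₀ ∈ skel X 1)
    (hX : ∀ k < n, Subsingleton (HomotopyGroup (Fin k) X x₀))
    (hY : ∀ k > n, Subsingleton (HomotopyGroup (Fin k) Y y₀))
    {f g : C(X, Y)} (hf : f x₀ = y₀) (hg : g x₀ = y₀)
    (hfg : ∀ p : Ω^ (Fin n) X x₀, piClass (mapLoop f hf p) = piClass (mapLoop g hg p)) :
    f.HomotopicRel g {x₀} := by
  obtain ⟨R, hR0, hR1, hRx⟩ := exists_collapse hx₀ hX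
  let r : C(X, X) := ⟨fun x => R x 1, by fun_prop⟩
  have hr : ∀ x ∈ skel X n, r x = x₀ := hR1
  have hid : (ContinuousMap.id X).HomotopicRel r {x₀} := by
    refine ⟨⟨⟨⟨fun tx => R tx.2 tx.1, by fun_prop⟩, hR0, fun x => rfl⟩, fun t x hx => ?_⟩⟩
    rw [mem_singleton_iff] at hx
    change R x t = x
    rw [hx, hRx]
    rfl
  have h1 : f.HomotopicRel (f.comp r) {x₀} := hid.comp_continuousMap f
  have h2 : g.HomotopicRel (g.comp r) {x₀} := hid.comp_continuousMap g
  -- Precomposing with `r` makes both maps constant on `skel X n`, so the homotopy can start as the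
  -- constant one there.
  refine h1.trans (.trans ?_ h2.symm)
  have : Nonempty C(I, Y) := ⟨ContinuousMap.const I y₀⟩
  obtain ⟨K, hK⟩ := exists_continuous_of_cells (X := X) (E := C(I, Y))
    (fun k e u => (∀ y ∈ closedBall (0 : Fin k → ℝ) 1,
        u y 0 = f (r (chi e y)) ∧ u y 1 = g (r (chi e y))) ∧
      (k < n → ∀ y ∈ closedBall (0 : Fin k → ℝ) 1, u y = ContinuousMap.const I y₀))
    (fun k e u v huv hu => ⟨fun y hy => by rw [← huv hy]; exact hu.1 y hy,
      fun hk y hy => by rw [← huv hy]; exact hu.2 hk y hy⟩) <| by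
    intro k K hK hlow e
    have hconst : k ≤ n → ∀ y ∈ sphere (0 : Fin k → ℝ) 1,
        K (chi e y) = ContinuousMap.const I y₀ := by
      intro hk y hy
      obtain ⟨m, hm, e', y', hy', he'⟩ := exists_chi_eq_of_mem_skel (chi_mem_skel_of_sphere e hy)
      rw [← he']
      exact (hlow m hm e').2 (hm.trans_le hk) y' hy'
    rcases lt_trichotomy k n with hk | rfl | hk
    · refine ⟨fun _ => ContinuousMap.const I y₀, continuousOn_const,
        fun y hy => (hconst hk.le y hy).symm, fun y hy => ?_, fun _ _ _ => rfl⟩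
      rw [hr _ (skel_mono hk (chi_mem_skel e hy)), hf, hg]
      exact ⟨rfl, rfl⟩
    · obtain ⟨H⟩ := piClass_eq_iff.1 (hfg (cellLoop r hr e))
      -- Over an `n`-cell the homotopy comes from the equality of the two classes of the loop that
      -- the cell defines through `r`.
      let Hc : C(Fin k → I, C(I, Y)) := (H.toContinuousMap.comp ContinuousMap.prodSwap).curry
      refine ⟨fun y => Hc (ballToCube y),
        (Hc.continuous.comp continuous_ballToCube).continuousOn, fun y hy => ?_, fun y hy => ?_,
        fun hk => absurd hk (lt_irrefl _)⟩
      · rw [hconst le_rfl y hy]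
        ext t
        change H (t, ballToCube y) = y₀
        rw [H.eq_fst t (ballToCube_mem_boundary hy)]
        exact (mapLoop f hf (cellLoop r hr e)).2 _ (ballToCube_mem_boundary hy)
      · have h3 : cubeToBall (ballToCube y) = y := cubeToBall_ballToCube hy
        constructor
        · refine (H.apply_zero (ballToCube y)).trans ?_
          change f (r (chi e (cubeToBall (ballToCube y)))) = _
          rw [h3]
        · refine (H.apply_one (ballToCube y)).trans ?_
          change g (r (chi e (cubeToBall (ballToCube y)))) = _
          rw [h3]
    · have hends : ∀ y ∈ sphere (0 : Fin k → ℝ) 1,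
          K (chi e y) 0 = f (r (chi e y)) ∧ K (chi e y) 1 = g (r (chi e y)) := by
        intro y hy
        obtain ⟨m, hm, e', y', hy', he'⟩ :=
          exists_chi_eq_of_mem_skel (chi_mem_skel_of_sphere e hy)
        rw [← he']
        exact (hlow m hm e').1 y' hy'
      -- A homotopy over a `k`-cell is obstructed in degree `k`, which is already harmless for `k =
      -- n + 1`.
      obtain ⟨w, hw, hwu, hw'⟩ := (extendsOverBall_of_subsingleton y₀ (hY k hk)).exists_homotopy
        (continuousOn_comp_chi_sphere hK e)
        ((f.comp r).continuous.comp_continuousOn (continuousOn_chi e))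
        ((g.comp r).continuous.comp_continuousOn (continuousOn_chi e))
        (fun y hy => (hends y hy).1) fun y hy => (hends y hy).2
      exact ⟨w, hw, hwu, hw', fun hk' => absurd hk' hk.not_gt⟩
  have hends : ∀ x, K x 0 = f (r x) ∧ K x 1 = g (r x) := fun x => by
    obtain ⟨m, e, y, hy, rfl⟩ := exists_chi_eq x
    exact (hK m e).1 y hy
  have hKx : K x₀ = ContinuousMap.const I y₀ := by
    obtain ⟨m, hm, e, y, hy, he⟩ := exists_chi_eq_of_mem_skel (skel_one_subset (n := n) hx₀)
    have := (hK m e).2 hm y hy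
    simpa only [he] using this
  refine ⟨⟨⟨⟨fun tx => K tx.2 tx.1, by fun_prop⟩, fun x => (hends x).1, fun x => (hends x).2⟩,
    fun t x hx => ?_⟩⟩
  rw [mem_singleton_iff] at hx
  subst hx
  change K x t = f (r x)
  rw [hKx, hr _ (skel_one_subset hx₀), hf]
  rfl

end Realization

/-! ### Comparison of Eilenberg–MacLane complexes. -/

section Equivalence

open Topology.Homotopy

lemma _root_.IsEilenbergMacLane.pathConnectedSpace {G : Type*} [Group G] {n : ℕ} [NeZero n]
    {X : Type*} [TopologicalSpace X] {x₀ : X} (h : IsEilenbergMacLane G n X x₀) :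
    PathConnectedSpace X := by
  have h0 := h.subsingleton_of_ne 0 (NeZero.ne n).symm
  exact pathConnectedSpace_iff_zerothHomotopy.2 ⟨⟨ZerothHomotopy.mk x₀⟩,
    (HomotopyGroup.pi0EquivZerothHomotopy (x := x₀)).symm.subsingleton⟩

/-- Being an Eilenberg–MacLane space does not depend on the base point. -/
lemma _root_.IsEilenbergMacLane.of_basepoint {G : Type*} [Group G] {n : ℕ} [NeZero n]
    {X : Type*} [TopologicalSpace X] {x₀ : X} (h : IsEilenbergMacLane G n X x₀) (x₁ : X) :
    IsEilenbergMacLane G n X x₁ := by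
  have := h.pathConnectedSpace
  let γ : Path x₁ x₀ := PathConnectedSpace.somePath x₁ x₀
  refine ⟨?_, fun k hk => ?_⟩
  · obtain ⟨a⟩ := h.nonempty_mulEquiv
    obtain ⟨b⟩ := nonempty_homotopyGroup_mulEquiv (k := n) γ
    exact ⟨b.trans a⟩
  · have hs := h.subsingleton_of_ne k hk
    rcases Nat.eq_zero_or_pos k with rfl | hpos
    · exact ((HomotopyGroup.pi0EquivZerothHomotopy (x := x₁)).trans
        (HomotopyGroup.pi0EquivZerothHomotopy (x := x₀)).symm).subsingleton
    · have : Nonempty (Fin k) := Fin.pos_iff_nonempty.1 hpos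
      obtain ⟨b⟩ := nonempty_homotopyGroup_mulEquiv (k := k) γ
      exact b.toEquiv.subsingleton

variable {X : Type*} [TopologicalSpace X] [T2Space X] [Topology.CWComplex (Set.univ : Set X)]
  {Y : Type*} [TopologicalSpace Y] [T2Space Y] [Topology.CWComplex (Set.univ : Set Y)]

/-- The frontier of a cell of positive dimension is nonempty and lies in a lower skeleton, so one
descends to a vertex. -/
lemma exists_mem_skel_one [Nonempty X] : ∃ x : X, x ∈ skel X 1 := by
  have key : ∀ k, (∃ x : X, x ∈ skel X k) → ∃ x : X, x ∈ skel X 1 := by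
    intro k
    induction k with
    | zero =>
      rintro ⟨x, hx⟩
      obtain ⟨m, hm, -⟩ := mem_skel_iff.1 hx
      exact absurd hm (Nat.not_lt_zero m)
    | succ k ih =>
      rintro ⟨x, hx⟩
      rcases Nat.eq_zero_or_pos k with rfl | hpos
      · exact ⟨x, hx⟩
      rcases mem_skel_succ_iff.1 hx with hx | ⟨e, -⟩
      · exact ih ⟨x, hx⟩
      · have : Nonempty (Fin k) := Fin.pos_iff_nonempty.1 hpos
        exact ih ⟨chi e fun _ => 1, chi_mem_skel_of_sphere e (by
          rw [mem_sphere_zero_iff_norm, pi_norm_const, norm_one])⟩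
  obtain ⟨k, hk⟩ := iUnion_skel (Classical.arbitrary X)
  exact key k ⟨_, hk⟩

/-- Eilenberg–MacLane complexes of the same type, pointed at vertices, are homotopy equivalent. -/
theorem pointedHomotopyEquivalent {G : Type*} [Group G] {n : ℕ} [NeZero n] {x₀ : X} {y₀ : Y}
    (hX : IsEilenbergMacLane G n X x₀) (hY : IsEilenbergMacLane G n Y y₀)
    (hx₀ : x₀ ∈ skel X 1) (hy₀ : y₀ ∈ skel Y 1) : PointedHomotopyEquivalent X x₀ Y y₀ := by
  have := hX.pathConnectedSpace
  have := hY.pathConnectedSpace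
  obtain ⟨a⟩ := hX.nonempty_mulEquiv
  obtain ⟨b⟩ := hY.nonempty_mulEquiv
  let φ : HomotopyGroup (Fin n) X x₀ ≃* HomotopyGroup (Fin n) Y y₀ := a.trans b.symm
  have hXlt k (hk : k < n) := hX.subsingleton_of_ne k hk.ne
  have hYlt k (hk : k < n) := hY.subsingleton_of_ne k hk.ne
  have hXgt k (hk : k > n) := hX.subsingleton_of_ne k hk.ne'
  have hYgt k (hk : k > n) := hY.subsingleton_of_ne k hk.ne'
  obtain ⟨f, hf, hfφ⟩ := exists_map_inducing hx₀ hXlt hYgt φ.toMonoidHom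
  obtain ⟨g, hg, hgφ⟩ := exists_map_inducing hy₀ hYlt hXgt φ.symm.toMonoidHom
  refine ⟨f, g, hf, hg, homotopicRel_of_piClass_eq hx₀ hXlt hXgt ((congrArg g hf).trans hg) rfl ?_,
    homotopicRel_of_piClass_eq hy₀ hYlt hYgt ((congrArg f hg).trans hf) rfl ?_⟩
  · intro p
    exact (hgφ (mapLoop f hf p)).symm.trans
      ((congrArg φ.symm (hfφ p).symm).trans (φ.symm_apply_apply (piClass p)))
  · intro p
    exact (hfφ (mapLoop g hg p)).symm.trans
      ((congrArg φ (hgφ p).symm).trans (φ.apply_symm_apply (piClass p)))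

end Equivalence

end EilenbergMacLane

open EilenbergMacLane in
theorem mainTheorem11 {G : Type*} [CommGroup G] (n : ℕ) [NeZero n]
    {X : Type*} [TopologicalSpace X] [T2Space X] [Topology.CWComplex (Set.univ : Set X)] (x₀ : X)
    {Y : Type*} [TopologicalSpace Y] [T2Space Y] [Topology.CWComplex (Set.univ : Set Y)] (y₀ : Y)
    (hX : IsEilenbergMacLane G n X x₀) (hY : IsEilenbergMacLane G n Y y₀) :
    Nonempty (X ≃ₕ Y) ∧
      (x₀ ∈ Topology.RelCWComplex.skeleton (Set.univ : Set X) 0 →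
        y₀ ∈ Topology.RelCWComplex.skeleton (Set.univ : Set Y) 0 →
        PointedHomotopyEquivalent X x₀ Y y₀) := by
  constructor
  -- The given base points need not be vertices; change of base point allows replacing them by
  -- vertices.
  · have : Nonempty X := ⟨x₀⟩
    have : Nonempty Y := ⟨y₀⟩
    obtain ⟨x₁, hx₁⟩ := exists_mem_skel_one (X := X)
    obtain ⟨y₁, hy₁⟩ := exists_mem_skel_one (X := Y)
    obtain ⟨f, g, -, -, hgf, hfg⟩ :=
      pointedHomotopyEquivalent (hX.of_basepoint x₁) (hY.of_basepoint y₁) hx₁ hy₁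
    exact ⟨⟨f, g, hgf.homotopic, hfg.homotopic⟩⟩
  · intro hx hy
    refine pointedHomotopyEquivalent hX hY ?_ ?_
    · simpa [skel, Topology.RelCWComplex.skeleton] using hx
    · simpa [skel, Topology.RelCWComplex.skeleton] using hy
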